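/- Let $\Sigma$ be a $2$-polygraph: a directed graph $(\Sigma_0,\Sigma_1)$ together with a set $\Sigma_2$ of $2$-cells $\varphi : p \Rightarrow q$, each between two parallel $1$-cells of the free category $\Sigma_1^*$. Let $\Sigma_2^*$ and $\Sigma_2^\top$ be the free $2$-category and the free $(2,1)$-category generated by $\Sigma$, with $0$-composition written as juxtaposition and $1$-composition written $\star_1$. A rewriting step is a $2$-cell $u\varphi v$ with $\varphi\in\Sigma_2$ and $u,v\in\Sigma_1^*$; rewriting sequences $f_1\cdots f_n$ are finite, possibly empty, composable sequences of steps. $\Sigma$ is quasi-convergent if it is confluent (any two rewriting sequences $u\Rightarrow v$, $u\Rightarrow w$ can be continued to a common target) and quasi-terminating (for every infinite sequence $(u_n)$ with a rewriting step from each $u_n$ to $u_{n+1}$, some $1$-cell occurs infinitely often among the $u_n$). Let $(W,\prec)$ be a well-founded partially ordered set and $\psi$ a map from the rewriting steps of $\Sigma$ to $W$. * A local branching is a pair $(f,g)$ of rewriting steps with the same source. A confluence diagram $(f\cdot f',g\cdot g')$ of it, with $f',g'$ rewriting sequences having the same target, is strictly decreasing if all labels of steps in $f'$ are $\prec\psi(f)$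 and all labels of steps in $g'$ are $\prec\psi(g)$. $(\Sigma,\psi)$ is strictly decreasing if every local branching has a strictly decreasing confluence diagram. * $\psi$ is compatible with contexts if, for every strictly decreasing confluence diagram $(f\cdot f',g\cdot g')$ of a local branching and all composable $1$-cells $u_1,u_2$, the diagram $(u_1fu_2\cdot u_1f'u_2,\;u_1gu_2\cdot u_1g'u_2)$ is strictly decreasing. * A Peiffer branching is a local branching $(fv,ug)$ (up to order) with $f:u\Rightarrow u'$ and $g:v\Rightarrow v'$ rewriting steps. A critical branching is a local branching $(f,g)$ with $f\neq g$ that is not Peiffer and is minimal for the order given by $(f,g)\sqsubseteq(wfw',wgw')$. * A $2$-loop is a $2$-cell $f$ of $\Sigma_2^*$ with equal source and target. Equivalence of $2$-loops is the equivalence relation generated by $f\star_1 g\sim g\star_1 f$. A $2$-loop $f$ is elementary if it is not an identity, if every decomposition $f=g\star_1h\star_1k$ with $h$ a $2$-loop has $h$ an identity or $h=f$, and if $f$ is not of the form $ugv$ with $g$ a $2$-loop and $u,v$ $1$-cells that are not both identities. * A strictly decreasing Squier completion of $(\Sigma,\psi)$ consists of a $3$-cell $f\star_1f'\Rrightarrow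 g\star_1g'$ for each critical branching $(f,g)$ (taken in one or both of its orders), where $(f\cdot f',g\cdot g')$ is a chosen strictly decreasing confluence diagram, and of a $3$-cell $\alpha\Rrightarrow 1$ for one chosen elementary $2$-loop $\alpha$ in each equivalence class of elementary $2$-loops. * For a set $\Gamma$ of $3$-cells between parallel $2$-cells of $\Sigma_2^\top$, let $\equiv_\Gamma$ be the congruence on $2$-cells of $\Sigma_2^\top$ generated by $\Gamma$. $(\Sigma,\psi)$ is Peiffer decreasing with respect to $\Gamma$ if for all rewriting steps $f:u\Rightarrow u'$, $g:v\Rightarrow v'$ with $u,v$ composable, the branching $(fv,ug)$ has a strictly decreasing confluence diagram $(fv\cdot f',ug\cdot g')$ such that $u'g\star_1(fv')^-\equiv_\Gamma f'\star_1(g')^-$. * $\Gamma$ is a homotopy basis of $\Sigma_2^\top$ if for any two parallel $2$-cells $f,g$ of $\Sigma_2^\top$ there is a $3$-cell $f\Rrightarrow g$ in the free $(3,1)$-category generated by $(\Sigma,\Gamma)$. $\Sigma$ has finite derivation type if $\Sigma_2^\top$ has a finite homotopy basis. **Proposition.** Let $(\Sigma,\psi)$ be strictly decreasing and $\Sigma$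 quasi-convergent, let $\psi$ be compatible with contexts, and let $(\Sigma,\psi)$ be Peiffer decreasing with respect to some strictly decreasing Squier completion of $(\Sigma,\psi)$. If $\Sigma$ has finitely many $2$-cells and finitely many equivalence classes of elementary $2$-loops, then $\Sigma$ has finite derivation type. -/

import Mathlib

universe u v w t

/-- A `1`-polygraph: a directed graph, with `Gen x y` the set of generating `1`-cells `x → y`. -/
structure OnePolygraph where
  Obj : Type u
  Gen : Obj → Obj → Type v

instance OnePolygraph.instQuiver (Q : OnePolygraph.{u, v}) : Quiver Q.Obj := ⟨Q.Gen⟩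

/-- The `1`-cells `x → y` of the free category over a `1`-polygraph: composable paths of
generating `1`-cells, with `Quiver.Path.comp` as composition and `Quiver.Path.nil` as identity. -/
abbrev OnePolygraph.Cell1 (Q : OnePolygraph.{u, v}) (x y : Q.Obj) : Type (max u v) :=
  Quiver.Path x y

/-- A `2`-polygraph: a `1`-polygraph together with a set of `2`-cells, each with a source and a
target which are parallel `1`-cells of the free category. `Rule p q` is the set of the `2`-cells
with source `p` and target `q`. -/
structure TwoPolygraph extends OnePolygraph.{u, v} where
  Rule : {x y : Obj} → toOnePolygraph.Cell1 x y → toOnePolygraph.Cell1 x y → Type w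

namespace TwoPolygraph

variable {P : TwoPolygraph.{u, v, w}}

/-- The set `Σ₂` of all `2`-cells of a `2`-polygraph. -/
def AllRules (P : TwoPolygraph.{u, v, w}) : Type (max u v w) :=
  Σ (x : P.Obj) (y : P.Obj) (p : P.Cell1 x y) (q : P.Cell1 x y), P.Rule p q

/-! ## Rewriting steps and rewriting sequences -/

/-- A rewriting step `l φ r` from `u` to `v`, where `φ` is a `2`-cell of the polygraph. -/
structure Step {x y : P.Obj} (u v : P.Cell1 x y) where
  {a : P.Obj}
  {b : P.Obj}
  {p : P.Cell1 a b}
  {q : P.Cell1 a b}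
  l : P.Cell1 x a
  φ : P.Rule p q
  r : P.Cell1 b y
  src_eq : u = (l.comp p).comp r
  tgt_eq : v = (l.comp q).comp r

/-- `c f`, for a `1`-cell `c` and a rewriting step `f`. -/
def Step.whiskerLeft {x y z : P.Obj} (c : P.Cell1 z x) {u v : P.Cell1 x y} (f : Step u v) :
    Step (c.comp u) (c.comp v) where
  l := c.comp f.l
  φ := f.φ
  r := f.r
  src_eq := by simp only [congrArg (Quiver.Path.comp c) f.src_eq, Quiver.Path.comp_assoc]
  tgt_eq := by simp only [congrArg (Quiver.Path.comp c) f.tgt_eq, Quiver.Path.comp_assoc]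

/-- `f c`, for a `1`-cell `c` and a rewriting step `f`. -/
def Step.whiskerRight {x y z : P.Obj} {u v : P.Cell1 x y} (f : Step u v) (c : P.Cell1 y z) :
    Step (u.comp c) (v.comp c) where
  l := f.l
  φ := f.φ
  r := f.r.comp c
  src_eq := by
    simp only [congrArg (fun e => Quiver.Path.comp e c) f.src_eq, Quiver.Path.comp_assoc]
  tgt_eq := by
    simp only [congrArg (fun e => Quiver.Path.comp e c) f.tgt_eq, Quiver.Path.comp_assoc]

/-- Finite (possibly empty) rewriting sequences from `u` to `v`. -/
inductive RSeq {x y : P.Obj} : P.Cell1 x y → P.Cell1 x y → Type (max u v w)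
  | nil (u : P.Cell1 x y) : RSeq u u
  | cons {u v w : P.Cell1 x y} (f : Step u v) (s : RSeq v w) : RSeq u w

namespace RSeq

/-- Concatenation of rewriting sequences. -/
def append {x y : P.Obj} {u v w : P.Cell1 x y} : RSeq u v → RSeq v w → RSeq u w
  | nil _, s => s
  | cons f r, s => cons f (append r s)

def whiskerLeft {x y z : P.Obj} (c : P.Cell1 z x) {u v : P.Cell1 x y} :
    RSeq u v → RSeq (c.comp u) (c.comp v)
  | nil u => nil (c.comp u)
  | cons f s => cons (f.whiskerLeft c) (whiskerLeft c s)

def whiskerRight {x y z : P.Obj} {u v : P.Cell1 x y} (s : RSeq u v) (c : P.Cell1 y z) :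
    RSeq (u.comp c) (v.comp c) :=
  match s with
  | nil u => nil (u.comp c)
  | cons f s => cons (f.whiskerRight c) (whiskerRight s c)

end RSeq

/-! ## Peiffer relations, the free `2`-category and the free `(2,1)`-category -/

/-- The rewriting steps `a`, `b`, `c`, `d` form a square
`a = l φ (m p' r)`, `b = (l q m) χ r`, `c = (l p m) χ r`, `d = l φ (m q' r)`, where
`φ : p ⇒ q` and `χ : p' ⇒ q'` are `2`-cells of the polygraph acting on disjoint factors of the
word `l p m p' r`. -/
inductive PeifferSquare {x y : P.Obj} {u₀ u₁ u₂ u₃ : P.Cell1 x y} :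
    Step u₀ u₁ → Step u₁ u₃ → Step u₀ u₂ → Step u₂ u₃ → Prop
  | mk {i j k n : P.Obj} {p q : P.Cell1 i j} {p' q' : P.Cell1 k n}
      (l : P.Cell1 x i) (φ : P.Rule p q) (m : P.Cell1 j k) (χ : P.Rule p' q') (r : P.Cell1 n y)
      {ra rd : P.Cell1 j y} {lb lc : P.Cell1 x k}
      (hra : ra = (m.comp p').comp r) (hrd : rd = (m.comp q').comp r)
      (hlb : lb = (l.comp q).comp m) (hlc : lc = (l.comp p).comp m)
      (sa : u₀ = (l.comp p).comp ra) (ta : u₁ = (l.comp q).comp ra)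
      (sb : u₁ = (lb.comp p').comp r) (tb : u₃ = (lb.comp q').comp r)
      (sc : u₀ = (lc.comp p').comp r) (tc : u₂ = (lc.comp q').comp r)
      (sd : u₂ = (l.comp p).comp rd) (td : u₃ = (l.comp q).comp rd) :
      PeifferSquare ⟨l, φ, ra, sa, ta⟩ ⟨lb, χ, r, sb, tb⟩ ⟨lc, χ, r, sc, tc⟩ ⟨l, φ, rd, sd, td⟩

theorem PeifferSquare.whiskerLeft {x y z : P.Obj} (e : P.Cell1 z x)
    {u₀ u₁ u₂ u₃ : P.Cell1 x y} {a : Step u₀ u₁} {b : Step u₁ u₃} {c : Step u₀ u₂}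
    {d : Step u₂ u₃} (h : PeifferSquare a b c d) :
    PeifferSquare (a.whiskerLeft e) (b.whiskerLeft e) (c.whiskerLeft e) (d.whiskerLeft e) := by
  obtain ⟨l, φ, m, χ, r, hra, hrd, hlb, hlc, sa, ta, sb, tb, sc, tc, sd, td⟩ := h
  exact .mk (e.comp l) φ m χ r hra hrd (by simp only [hlb, Quiver.Path.comp_assoc])
    (by simp only [hlc, Quiver.Path.comp_assoc]) _ _ _ _ _ _ _ _

theorem PeifferSquare.whiskerRight {x y z : P.Obj} (e : P.Cell1 y z)
    {u₀ u₁ u₂ u₃ : P.Cell1 x y} {a : Step u₀ u₁} {b : Step u₁ u₃} {c : Step u₀ u₂}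
    {d : Step u₂ u₃} (h : PeifferSquare a b c d) :
    PeifferSquare (a.whiskerRight e) (b.whiskerRight e) (c.whiskerRight e)
      (d.whiskerRight e) := by
  obtain ⟨l, φ, m, χ, r, hra, hrd, hlb, hlc, sa, ta, sb, tb, sc, tc, sd, td⟩ := h
  exact .mk l φ m χ (r.comp e) (by simp only [hra, Quiver.Path.comp_assoc])
    (by simp only [hrd, Quiver.Path.comp_assoc]) hlb hlc _ _ _ _ _ _ _ _

/-- Equality of rewriting sequences up to Peiffer relations, that is, equality of the
corresponding `2`-cells in the free `2`-category. -/
inductive RSeq.Rel {x y : P.Obj} : {u v : P.Cell1 x y} → RSeq u v → RSeq u v → Prop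
  | refl {u v : P.Cell1 x y} (s : RSeq u v) : Rel s s
  | symm {u v : P.Cell1 x y} {s s' : RSeq u v} : Rel s s' → Rel s' s
  | trans {u v : P.Cell1 x y} {s s' s'' : RSeq u v} : Rel s s' → Rel s' s'' → Rel s s''
  | cons {u v w : P.Cell1 x y} (f : Step u v) {s s' : RSeq v w} :
      Rel s s' → Rel (RSeq.cons f s) (RSeq.cons f s')
  | peiffer {u₀ u₁ u₂ u₃ w : P.Cell1 x y} {a : Step u₀ u₁} {b : Step u₁ u₃} {c : Step u₀ u₂}
      {d : Step u₂ u₃} (h : PeifferSquare a b c d) (s : RSeq u₃ w) :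
      Rel (RSeq.cons a (RSeq.cons b s)) (RSeq.cons c (RSeq.cons d s))

theorem RSeq.Rel.append {x y : P.Obj} {u v w : P.Cell1 x y} {s s' : RSeq u v} {r r' : RSeq v w}
    (hs : RSeq.Rel s s') (hr : RSeq.Rel r r') : RSeq.Rel (s.append r) (s'.append r') := by
  have left : ∀ {u v : P.Cell1 x y} {s s' : RSeq u v}, RSeq.Rel s s' →
      ∀ {w : P.Cell1 x y} (r : RSeq v w), RSeq.Rel (s.append r) (s'.append r) := by
    intro u v s s' h
    induction h with
    | refl s => exact fun r => .refl _
    | symm _ ih => exact fun r => .symm (ih r)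
    | trans _ _ ih₁ ih₂ => exact fun r => .trans (ih₁ r) (ih₂ r)
    | cons f _ ih => exact fun r => .cons f (ih r)
    | peiffer h s => exact fun r => .peiffer h (s.append r)
  have right : ∀ {u v : P.Cell1 x y} (s : RSeq u v) {w : P.Cell1 x y} {r r' : RSeq v w},
      RSeq.Rel r r' → RSeq.Rel (s.append r) (s.append r') := by
    intro u v s
    induction s with
    | nil _ => exact fun h => h
    | cons f s ih => exact fun h => .cons f (ih h)
  exact .trans (left hs r) (right s' hr)

theorem RSeq.Rel.whiskerLeft {x y z : P.Obj} (c : P.Cell1 z x) {u v : P.Cell1 x y}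
    {s s' : RSeq u v} (h : RSeq.Rel s s') :
    RSeq.Rel (s.whiskerLeft c) (s'.whiskerLeft c) := by
  induction h with
  | refl s => exact .refl _
  | symm _ ih => exact .symm ih
  | trans _ _ ih₁ ih₂ => exact .trans ih₁ ih₂
  | cons f _ ih => exact .cons _ ih
  | peiffer h s => exact .peiffer (h.whiskerLeft c) _

theorem RSeq.Rel.whiskerRight {x y z : P.Obj} (c : P.Cell1 y z) {u v : P.Cell1 x y}
    {s s' : RSeq u v} (h : RSeq.Rel s s') :
    RSeq.Rel (s.whiskerRight c) (s'.whiskerRight c) := by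
  induction h with
  | refl s => exact .refl _
  | symm _ ih => exact .symm ih
  | trans _ _ ih₁ ih₂ => exact .trans ih₁ ih₂
  | cons f _ ih => exact .cons _ ih
  | peiffer h s => exact .peiffer (h.whiskerRight c) _

instance RSeq.setoid {x y : P.Obj} (u v : P.Cell1 x y) : Setoid (RSeq u v) :=
  ⟨RSeq.Rel, .refl, .symm, .trans⟩

/-- The `2`-cells `u ⇒ v` of the free `2`-category `Σ₂^*`. -/
def Cell2 {x y : P.Obj} (u v : P.Cell1 x y) : Type (max u v w) :=
  Quotient (RSeq.setoid u v)

namespace Cell2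

/-- The identity `2`-cell on `u`. -/
def id {x y : P.Obj} (u : P.Cell1 x y) : Cell2 u u := Quotient.mk _ (RSeq.nil u)

/-- The `1`-composition of `2`-cells. -/
def comp {x y : P.Obj} {u v w : P.Cell1 x y} : Cell2 u v → Cell2 v w → Cell2 u w :=
  Quotient.map₂ RSeq.append fun _ _ h _ _ h' => RSeq.Rel.append h h'

def whiskerLeft {x y z : P.Obj} (c : P.Cell1 z x) {u v : P.Cell1 x y} :
    Cell2 u v → Cell2 (c.comp u) (c.comp v) :=
  Quotient.map (RSeq.whiskerLeft c) fun _ _ h => RSeq.Rel.whiskerLeft c h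

def whiskerRight {x y z : P.Obj} {u v : P.Cell1 x y} (f : Cell2 u v) (c : P.Cell1 y z) :
    Cell2 (u.comp c) (v.comp c) :=
  Quotient.map (fun s => s.whiskerRight c) (fun _ _ h => RSeq.Rel.whiskerRight c h) f

end Cell2

/-- Formal composites of rewriting steps and formal inverses. -/
inductive Zigzag {x y : P.Obj} : P.Cell1 x y → P.Cell1 x y → Type (max u v w)
  | id (u : P.Cell1 x y) : Zigzag u u
  | step {u v : P.Cell1 x y} (f : Step u v) : Zigzag u v
  | comp {u v w : P.Cell1 x y} (f : Zigzag u v) (g : Zigzag v w) : Zigzag u w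
  | inv {u v : P.Cell1 x y} (f : Zigzag u v) : Zigzag v u

namespace Zigzag

def whiskerLeft {x y z : P.Obj} (c : P.Cell1 z x) {u v : P.Cell1 x y} :
    Zigzag u v → Zigzag (c.comp u) (c.comp v)
  | id u => id (c.comp u)
  | step f => step (f.whiskerLeft c)
  | comp f g => comp (whiskerLeft c f) (whiskerLeft c g)
  | inv f => inv (whiskerLeft c f)

def whiskerRight {x y z : P.Obj} {u v : P.Cell1 x y} (s : Zigzag u v) (c : P.Cell1 y z) :
    Zigzag (u.comp c) (v.comp c) :=
  match s with
  | id u => id (u.comp c)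
  | step f => step (f.whiskerRight c)
  | comp f g => comp (whiskerRight f c) (whiskerRight g c)
  | inv f => inv (whiskerRight f c)

/-- The congruence generated by the groupoid axioms (for the `1`-composition) and the Peiffer
relations. -/
inductive Rel {x y : P.Obj} : {u v : P.Cell1 x y} → Zigzag u v → Zigzag u v → Prop
  | refl {u v : P.Cell1 x y} (f : Zigzag u v) : Rel f f
  | symm {u v : P.Cell1 x y} {f g : Zigzag u v} : Rel f g → Rel g f
  | trans {u v : P.Cell1 x y} {f g h : Zigzag u v} : Rel f g → Rel g h → Rel f h
  | comp {u v w : P.Cell1 x y} {f f' : Zigzag u v} {g g' : Zigzag v w} :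
      Rel f f' → Rel g g' → Rel (Zigzag.comp f g) (Zigzag.comp f' g')
  | inv {u v : P.Cell1 x y} {f f' : Zigzag u v} :
      Rel f f' → Rel (Zigzag.inv f) (Zigzag.inv f')
  | assoc {u v w z : P.Cell1 x y} (f : Zigzag u v) (g : Zigzag v w) (h : Zigzag w z) :
      Rel (Zigzag.comp (Zigzag.comp f g) h) (Zigzag.comp f (Zigzag.comp g h))
  | id_comp {u v : P.Cell1 x y} (f : Zigzag u v) : Rel (Zigzag.comp (Zigzag.id u) f) f
  | comp_id {u v : P.Cell1 x y} (f : Zigzag u v) : Rel (Zigzag.comp f (Zigzag.id v)) f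
  | inv_comp {u v : P.Cell1 x y} (f : Zigzag u v) :
      Rel (Zigzag.comp (Zigzag.inv f) f) (Zigzag.id v)
  | comp_inv {u v : P.Cell1 x y} (f : Zigzag u v) :
      Rel (Zigzag.comp f (Zigzag.inv f)) (Zigzag.id u)
  | peiffer {u₀ u₁ u₂ u₃ : P.Cell1 x y} {a : Step u₀ u₁} {b : Step u₁ u₃} {c : Step u₀ u₂}
      {d : Step u₂ u₃} (h : PeifferSquare a b c d) :
      Rel (Zigzag.comp (Zigzag.step a) (Zigzag.step b))
        (Zigzag.comp (Zigzag.step c) (Zigzag.step d))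

theorem Rel.whiskerLeft {x y z : P.Obj} (c : P.Cell1 z x) {u v : P.Cell1 x y}
    {f g : Zigzag u v} (h : Rel f g) : Rel (f.whiskerLeft c) (g.whiskerLeft c) := by
  induction h with
  | refl s => exact .refl _
  | symm _ ih => exact .symm ih
  | trans _ _ ih₁ ih₂ => exact .trans ih₁ ih₂
  | comp _ _ ih₁ ih₂ => exact .comp ih₁ ih₂
  | inv _ ih => exact .inv ih
  | assoc f g h => exact .assoc _ _ _
  | id_comp f => exact .id_comp _
  | comp_id f => exact .comp_id _
  | inv_comp f => exact .inv_comp _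
  | comp_inv f => exact .comp_inv _
  | peiffer h => exact .peiffer (h.whiskerLeft c)

theorem Rel.whiskerRight {x y z : P.Obj} (c : P.Cell1 y z) {u v : P.Cell1 x y}
    {f g : Zigzag u v} (h : Rel f g) : Rel (f.whiskerRight c) (g.whiskerRight c) := by
  induction h with
  | refl s => exact .refl _
  | symm _ ih => exact .symm ih
  | trans _ _ ih₁ ih₂ => exact .trans ih₁ ih₂
  | comp _ _ ih₁ ih₂ => exact .comp ih₁ ih₂
  | inv _ ih => exact .inv ih
  | assoc f g h => exact .assoc _ _ _
  | id_comp f => exact .id_comp _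
  | comp_id f => exact .comp_id _
  | inv_comp f => exact .inv_comp _
  | comp_inv f => exact .comp_inv _
  | peiffer h => exact .peiffer (h.whiskerRight c)

instance setoid {x y : P.Obj} (u v : P.Cell1 x y) : Setoid (Zigzag u v) :=
  ⟨Rel, .refl, .symm, .trans⟩

end Zigzag

/-- The `2`-cells `u ⇒ v` of the free `(2,1)`-category `Σ₂^⊤`. -/
def TCell {x y : P.Obj} (u v : P.Cell1 x y) : Type (max u v w) :=
  Quotient (Zigzag.setoid u v)

namespace TCell

def id {x y : P.Obj} (u : P.Cell1 x y) : TCell u u := Quotient.mk _ (Zigzag.id u)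

def step {x y : P.Obj} {u v : P.Cell1 x y} (f : Step u v) : TCell u v :=
  Quotient.mk _ (Zigzag.step f)

/-- The `1`-composition `f ⋆₁ g`. -/
def comp {x y : P.Obj} {u v w : P.Cell1 x y} : TCell u v → TCell v w → TCell u w :=
  Quotient.map₂ Zigzag.comp fun _ _ h _ _ h' => Zigzag.Rel.comp h h'

/-- The inverse `f⁻` for the `1`-composition. -/
def inv {x y : P.Obj} {u v : P.Cell1 x y} : TCell u v → TCell v u :=
  Quotient.map Zigzag.inv fun _ _ h => Zigzag.Rel.inv h

def whiskerLeft {x y z : P.Obj} (c : P.Cell1 z x) {u v : P.Cell1 x y} :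
    TCell u v → TCell (c.comp u) (c.comp v) :=
  Quotient.map (Zigzag.whiskerLeft c) fun _ _ h => Zigzag.Rel.whiskerLeft c h

def whiskerRight {x y z : P.Obj} {u v : P.Cell1 x y} (f : TCell u v) (c : P.Cell1 y z) :
    TCell (u.comp c) (v.comp c) :=
  Quotient.map (fun s => s.whiskerRight c) (fun _ _ h => Zigzag.Rel.whiskerRight c h) f

end TCell

/-- The composite in the free `(2,1)`-category of a rewriting sequence. -/
def RSeq.toZigzag {x y : P.Obj} {u v : P.Cell1 x y} : RSeq u v → Zigzag u v
  | RSeq.nil u => Zigzag.id u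
  | RSeq.cons f s => Zigzag.comp (Zigzag.step f) s.toZigzag

def RSeq.toTCell {x y : P.Obj} {u v : P.Cell1 x y} (s : RSeq u v) : TCell u v :=
  Quotient.mk _ s.toZigzag

theorem RSeq.Rel.toZigzag {x y : P.Obj} {u v : P.Cell1 x y} {s s' : RSeq u v}
    (h : RSeq.Rel s s') : Zigzag.Rel s.toZigzag s'.toZigzag := by
  induction h with
  | refl s => exact .refl _
  | symm _ ih => exact .symm ih
  | trans _ _ ih₁ ih₂ => exact .trans ih₁ ih₂
  | cons f _ ih => exact .comp (.refl _) ih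
  | peiffer h s =>
    exact .trans (.symm (.assoc _ _ _)) (.trans (.comp (.peiffer h) (.refl _)) (.assoc _ _ _))

/-- The canonical map from the `2`-cells of `Σ₂^*` to the `2`-cells of `Σ₂^⊤`. -/
def Cell2.toTCell {x y : P.Obj} {u v : P.Cell1 x y} : Cell2 u v → TCell u v :=
  Quotient.map RSeq.toZigzag fun _ _ h => RSeq.Rel.toZigzag h

/-! ## Globular extensions and homotopy bases -/

/-- A `2`-sphere of the free `(2,1)`-category: a pair of parallel `2`-cells. -/
structure Sphere (P : TwoPolygraph.{u, v, w}) where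
  {x : P.Obj}
  {y : P.Obj}
  {u : P.Cell1 x y}
  {v : P.Cell1 x y}
  src : TCell u v
  tgt : TCell u v

/-- A globular extension of the free `(2,1)`-category: a set of `3`-cells, each with a `2`-source
and a `2`-target that form a `2`-sphere. -/
structure GlobularExtension (P : TwoPolygraph.{u, v, w}) where
  Cell : Type t
  sphere : Cell → Sphere P

namespace GlobularExtension

/-- `f ≡_Γ g`: equality of the `2`-cells `f` and `g` in the quotient of the free
`(2,1)`-category by the congruence generated by `Γ`. -/
inductive Equal (Γ : GlobularExtension.{u, v, w, t} P) :
    {x y : P.Obj} → {u v : P.Cell1 x y} → TCell u v → TCell u v → Prop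
  | gen (A : Γ.Cell) : Equal Γ (Γ.sphere A).src (Γ.sphere A).tgt
  | refl {x y : P.Obj} {u v : P.Cell1 x y} (f : TCell u v) : Equal Γ f f
  | symm {x y : P.Obj} {u v : P.Cell1 x y} {f g : TCell u v} : Equal Γ f g → Equal Γ g f
  | trans {x y : P.Obj} {u v : P.Cell1 x y} {f g h : TCell u v} :
      Equal Γ f g → Equal Γ g h → Equal Γ f h
  | comp {x y : P.Obj} {u v w : P.Cell1 x y} {f f' : TCell u v} {g g' : TCell v w} :
      Equal Γ f f' → Equal Γ g g' → Equal Γ (f.comp g) (f'.comp g')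
  | whiskerLeft {x y z : P.Obj} (c : P.Cell1 z x) {u v : P.Cell1 x y} {f g : TCell u v} :
      Equal Γ f g → Equal Γ (f.whiskerLeft c) (g.whiskerLeft c)
  | whiskerRight {x y z : P.Obj} (c : P.Cell1 y z) {u v : P.Cell1 x y} {f g : TCell u v} :
      Equal Γ f g → Equal Γ (f.whiskerRight c) (g.whiskerRight c)

/-- Formal composites of the `3`-cells of `Γ`, of identities and of inverses. The `3`-cells
`f ⇛ g` of the free `(3,1)`-category generated by `(Σ, Γ)` are the classes of these composites
modulo the axioms of `(3,1)`-categories; below, only their existence is used. -/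
inductive Cell3 (Γ : GlobularExtension.{u, v, w, t} P) :
    {x y : P.Obj} → {u v : P.Cell1 x y} → TCell u v → TCell u v → Type (max u v w t)
  | gen (A : Γ.Cell) : Cell3 Γ (Γ.sphere A).src (Γ.sphere A).tgt
  | id {x y : P.Obj} {u v : P.Cell1 x y} (f : TCell u v) : Cell3 Γ f f
  | inv {x y : P.Obj} {u v : P.Cell1 x y} {f g : TCell u v} : Cell3 Γ f g → Cell3 Γ g f
  | comp₂ {x y : P.Obj} {u v : P.Cell1 x y} {f g h : TCell u v} :
      Cell3 Γ f g → Cell3 Γ g h → Cell3 Γ f h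
  | comp₁ {x y : P.Obj} {u v w : P.Cell1 x y} {f f' : TCell u v} {g g' : TCell v w} :
      Cell3 Γ f f' → Cell3 Γ g g' → Cell3 Γ (f.comp g) (f'.comp g')
  | whiskerLeft {x y z : P.Obj} (c : P.Cell1 z x) {u v : P.Cell1 x y} {f g : TCell u v} :
      Cell3 Γ f g → Cell3 Γ (f.whiskerLeft c) (g.whiskerLeft c)
  | whiskerRight {x y z : P.Obj} (c : P.Cell1 y z) {u v : P.Cell1 x y} {f g : TCell u v} :
      Cell3 Γ f g → Cell3 Γ (f.whiskerRight c) (g.whiskerRight c)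

/-- `Γ` is a homotopy basis: every `2`-sphere of the free `(2,1)`-category is filled by a
`3`-cell of the free `(3,1)`-category generated by `Γ`. -/
def IsHomotopyBasis (Γ : GlobularExtension.{u, v, w, t} P) : Prop :=
  ∀ S : Sphere P, Nonempty (Γ.Cell3 S.src S.tgt)

end GlobularExtension

/-- Finite derivation type: the free `(2,1)`-category admits a finite homotopy basis. -/
def HasFiniteDerivationType (P : TwoPolygraph.{u, v, w}) : Prop :=
  ∃ Γ : GlobularExtension.{u, v, w, 0} P, Finite Γ.Cell ∧ Γ.IsHomotopyBasis

/-! ## Quasi-convergence -/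

def IsConfluent (P : TwoPolygraph.{u, v, w}) : Prop :=
  ∀ {x y : P.Obj} {u v w : P.Cell1 x y}, RSeq u v → RSeq u w →
    ∃ z : P.Cell1 x y, Nonempty (RSeq v z) ∧ Nonempty (RSeq w z)

def IsQuasiTerminating (P : TwoPolygraph.{u, v, w}) : Prop :=
  ∀ {x y : P.Obj} (u : ℕ → P.Cell1 x y), (∀ n, Nonempty (Step (u n) (u (n + 1)))) →
    ∃ c : P.Cell1 x y, {n | u n = c}.Infinite

def IsQuasiConvergent (P : TwoPolygraph.{u, v, w}) : Prop :=
  P.IsConfluent ∧ P.IsQuasiTerminating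

/-! ## Local branchings -/

/-- A local branching: a pair of rewriting steps with the same source. -/
structure LocalBranching (P : TwoPolygraph.{u, v, w}) where
  {x : P.Obj}
  {y : P.Obj}
  {u : P.Cell1 x y}
  {v : P.Cell1 x y}
  {w : P.Cell1 x y}
  f : Step u v
  g : Step u w

namespace LocalBranching

def swap (b : LocalBranching P) : LocalBranching P := ⟨b.g, b.f⟩

/-- The local branching `(c f d, c g d)`. -/
def whisker (b : LocalBranching P) {x' y' : P.Obj} (c : P.Cell1 x' b.x) (d : P.Cell1 b.y y') :
    LocalBranching P :=
  ⟨(b.f.whiskerLeft c).whiskerRight d, (b.g.whiskerLeft c).whiskerRight d⟩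

def IsAspherical (b : LocalBranching P) : Prop := b = ⟨b.f, b.f⟩

/-- Peiffer branchings `(f v, u g)`, in this order or in the other one. -/
def IsPeiffer (b : LocalBranching P) : Prop :=
  ∃ (x y z : P.Obj) (u u' : P.Cell1 x y) (v v' : P.Cell1 y z) (f : Step u u') (g : Step v v'),
    b = ⟨f.whiskerRight v, g.whiskerLeft u⟩ ∨ b = ⟨g.whiskerLeft u, f.whiskerRight v⟩

def IsOverlapping (b : LocalBranching P) : Prop := ¬ b.IsAspherical ∧ ¬ b.IsPeiffer

/-- The order `⊑` on local branchings. -/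
def Sub (b' b : LocalBranching P) : Prop :=
  ∃ (x' y' : P.Obj) (c : P.Cell1 x' b'.x) (d : P.Cell1 b'.y y'), b = b'.whisker c d

/-- Critical branchings: overlapping branchings which are minimal for `⊑`. -/
def IsCritical (b : LocalBranching P) : Prop :=
  b.IsOverlapping ∧ ∀ b' : LocalBranching P, b'.Sub b → b.Sub b'

end LocalBranching

/-! ## Elementary `2`-loops -/

/-- A `2`-loop of the free `2`-category `Σ₂^*`. -/
structure Loop (P : TwoPolygraph.{u, v, w}) where
  {x : P.Obj}
  {y : P.Obj}
  {u : P.Cell1 x y}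
  cell : Cell2 u u

namespace Loop

def whisker (L : Loop P) {x' y' : P.Obj} (c : P.Cell1 x' L.x) (d : P.Cell1 L.y y') : Loop P :=
  ⟨(L.cell.whiskerLeft c).whiskerRight d⟩

/-- One circular permutation of a decomposition into rewriting steps: `f ⋆₁ g` and `g ⋆₁ f`,
where `f : u ⇒ v` and `g : v ⇒ u`. -/
inductive Rotation : Loop P → Loop P → Prop
  | mk {x y : P.Obj} {u v : P.Cell1 x y} (f : Cell2 u v) (g : Cell2 v u) :
      Rotation ⟨f.comp g⟩ ⟨g.comp f⟩

/-- Equivalence of `2`-loops: the equivalence relation generated by circular permutations. -/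
def equivalence (P : TwoPolygraph.{u, v, w}) : Setoid (Loop P) := Relation.EqvGen.setoid Rotation

def IsIdentity (L : Loop P) : Prop := L.cell = Cell2.id L.u

/-- Minimality with respect to the `1`-composition. -/
def IsMinimalComp (L : Loop P) : Prop :=
  ∀ (v : P.Cell1 L.x L.y) (g : Cell2 L.u v) (h : Cell2 v v) (k : Cell2 v L.u),
    L.cell = (g.comp h).comp k → IsIdentity ⟨h⟩ ∨ (⟨h⟩ : Loop P) = L

/-- Minimality by context: `L` is not `c L' d` with `L'` a loop and `c`, `d` not both
identities. -/
def IsMinimalContext (L : Loop P) : Prop :=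
  ∀ (L' : Loop P) {x' y' : P.Obj} (c : P.Cell1 x' L'.x) (d : P.Cell1 L'.y y'),
    L = L'.whisker c d → c.length = 0 ∧ d.length = 0

/-- Elementary `2`-loops (identities are not counted as elementary). -/
def IsElementary (L : Loop P) : Prop :=
  ¬ L.IsIdentity ∧ L.IsMinimalComp ∧ L.IsMinimalContext

end Loop

/-- The set of equivalence classes of elementary `2`-loops. -/
def ElementaryLoopClass (P : TwoPolygraph.{u, v, w}) : Type (max u v w) :=
  {c : Quotient (Loop.equivalence P) //
    ∃ L : Loop P, L.IsElementary ∧ Quotient.mk (Loop.equivalence P) L = c}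

/-! ## Labellings and strict decreasingness -/

/-- A labelling of the rewriting steps by elements of `W`. -/
def Labelling (P : TwoPolygraph.{u, v, w}) (W : Type t) : Type (max u v w t) :=
  ∀ {x y : P.Obj} {u v : P.Cell1 x y}, Step u v → W

/-- The set of labels of the rewriting steps of a rewriting sequence. -/
def Labelling.labels {W : Type t} (ψ : P.Labelling W) {x y : P.Obj} {u v : P.Cell1 x y} :
    RSeq u v → Set W
  | RSeq.nil _ => ∅
  | RSeq.cons f s => {ψ f} ∪ Labelling.labels ψ s

/-- The confluence diagram `(f · f', g · g')` of the local branching `(f, g)` is strictly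
decreasing. -/
def Labelling.IsStrictDiagram {W : Type t} [PartialOrder W] (ψ : P.Labelling W) {x y : P.Obj}
    {u v w z : P.Cell1 x y} (f : Step u v) (g : Step u w) (f' : RSeq v z) (g' : RSeq w z) : Prop :=
  (∀ k ∈ ψ.labels f', k < ψ f) ∧ (∀ k ∈ ψ.labels g', k < ψ g)

/-- Every local branching has a strictly decreasing confluence diagram. -/
def Labelling.IsStrictlyDecreasing {W : Type t} [PartialOrder W] (ψ : P.Labelling W) : Prop :=
  ∀ b : LocalBranching P, ∃ (z : P.Cell1 b.x b.y) (f' : RSeq b.v z) (g' : RSeq b.w z),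
    ψ.IsStrictDiagram b.f b.g f' g'

/-- Compatibility with contexts (for strictly decreasing confluence diagrams). -/
def Labelling.IsCompatibleWithContexts {W : Type t} [PartialOrder W] (ψ : P.Labelling W) : Prop :=
  ∀ {x y : P.Obj} {u v w z : P.Cell1 x y} (f : Step u v) (g : Step u w) (f' : RSeq v z)
    (g' : RSeq w z), ψ.IsStrictDiagram f g f' g' →
    ∀ {x' y' : P.Obj} (c : P.Cell1 x' x) (d : P.Cell1 y y'),
      ψ.IsStrictDiagram ((f.whiskerLeft c).whiskerRight d) ((g.whiskerLeft c).whiskerRight d)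
        ((f'.whiskerLeft c).whiskerRight d) ((g'.whiskerLeft c).whiskerRight d)

/-- Peiffer decreasingness of a strictly decreasing labelled `2`-polygraph with respect to `Γ`:
every Peiffer branching `(f v, u g)` has a strictly decreasing confluence diagram
`(f v · f', u g · g')` with `u' g ⋆₁ (f v')⁻ ≡_Γ f' ⋆₁ g'⁻`. -/
def Labelling.IsPeifferDecreasing {W : Type*} [PartialOrder W] (ψ : P.Labelling W)
    (Γ : GlobularExtension.{u, v, w, t} P) : Prop :=
  ∀ {x y z : P.Obj} {u u' : P.Cell1 x y} {v v' : P.Cell1 y z} (f : Step u u') (g : Step v v'),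
    ∃ (c : P.Cell1 x z) (f' : RSeq (u'.comp v) c) (g' : RSeq (u.comp v') c),
      ψ.IsStrictDiagram (f.whiskerRight v) (g.whiskerLeft u) f' g' ∧
      Γ.Equal ((TCell.step (g.whiskerLeft u')).comp (TCell.step (f.whiskerRight v')).inv)
        (f'.toTCell.comp g'.toTCell.inv)

/-- The choices that make up a strictly decreasing Squier's completion: a strictly decreasing
confluence diagram for every critical branching, and a representative of every class of elementary
`2`-loops. A critical branching may be taken in either of its two orders, or in both. -/
structure StrictSquierCompletion {W : Type t} [PartialOrder W] (ψ : P.Labelling W) where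
  crit : Set (LocalBranching P)
  isCritical : ∀ b ∈ crit, b.IsCritical
  covers : ∀ b : LocalBranching P, b.IsCritical → b ∈ crit ∨ b.swap ∈ crit
  apex : ∀ b : crit, P.Cell1 b.1.x b.1.y
  left : ∀ b : crit, RSeq b.1.v (apex b)
  right : ∀ b : crit, RSeq b.1.w (apex b)
  strict : ∀ b : crit, ψ.IsStrictDiagram b.1.f b.1.g (left b) (right b)
  loop : P.ElementaryLoopClass → Loop P
  isElementary : ∀ c, (loop c).IsElementary
  loop_class : ∀ c, Quotient.mk (Loop.equivalence P) (loop c) = c.1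

/-- The globular extension of a strictly decreasing Squier's completion: the `3`-cells
`f ⋆₁ f' ⇛ g ⋆₁ g'` for the critical branchings `(f, g)`, and the `3`-cells `α ⇛ 1` for the chosen
elementary `2`-loops `α`. -/
def StrictSquierCompletion.extension {W : Type t} [PartialOrder W] {ψ : P.Labelling W}
    (S : StrictSquierCompletion ψ) : GlobularExtension.{u, v, w, max u v w} P where
  Cell := S.crit ⊕ P.ElementaryLoopClass
  sphere := Sum.elim
    (fun b => ⟨(TCell.step b.1.f).comp (S.left b).toTCell,
      (TCell.step b.1.g).comp (S.right b).toTCell⟩)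
    (fun c => ⟨(S.loop c).cell.toTCell, TCell.id (S.loop c).u⟩)

end TwoPolygraph

/-!
An induction on the size of `2`-loops shows that the `3`-cells `α ⇛ 1` trivialize every loop, and
an induction on the length of the source shows that every local branching has a strictly decreasing
confluence diagram that commutes modulo the completion. Replacing the local peaks of a zigzag by
such diagrams decreases the multiset of its labels in the Dershowitz–Manna order, so every `2`-cell
of `Σ₂^⊤` is congruent to a valley `p ⋆₁ q⁻`. Quasi-termination replaces termination in Squier's
theorem as follows: every `1`-cell rewrites into a quasi-normal form, from which there is always a
way back, so that a valley between two copies of a quasi-normal form can be closed up into loops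
and is trivial. Hence parallel rewriting sequences are congruent, a valley between two equal
`1`-cells is trivial, and the completion is a homotopy basis. It is finite because the contexts of
a critical branching are infixes of the sources of the rules.
-/

namespace TwoPolygraph

open CategoryTheory hiding Quotient

variable {P : TwoPolygraph.{u, v, w}}

/-! ## Calculus in the quotient groupoid -/

namespace TCell

variable {x y : P.Obj} {u v w z : P.Cell1 x y}

theorem comp_assoc (f : TCell u v) (g : TCell v w) (h : TCell w z) :
    (f.comp g).comp h = f.comp (g.comp h) := by
  induction f, g using Quotient.inductionOn₂
  induction h using Quotient.inductionOn
  exact Quotient.sound (.assoc _ _ _)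

theorem id_comp (f : TCell u v) : (id u).comp f = f := by
  induction f using Quotient.inductionOn
  exact Quotient.sound (.id_comp _)

theorem comp_id (f : TCell u v) : f.comp (id v) = f := by
  induction f using Quotient.inductionOn
  exact Quotient.sound (.comp_id _)

theorem inv_comp (f : TCell u v) : f.inv.comp f = id v := by
  induction f using Quotient.inductionOn
  exact Quotient.sound (.inv_comp _)

theorem comp_inv (f : TCell u v) : f.comp f.inv = id u := by
  induction f using Quotient.inductionOn
  exact Quotient.sound (.comp_inv _)

theorem step_comp_step_of_peifferSquare {a : Step u v} {b : Step v z} {c : Step u w}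
    {d : Step w z} (h : PeifferSquare a b c d) :
    (step a).comp (step b) = (step c).comp (step d) :=
  Quotient.sound (.peiffer h)

end TCell

/-- The groupoid of the `1`-cells `x → y` and the `2`-cells of the free `(2,1)`-category between
them. The `1`-cells are wrapped in a structure since they are also the paths of a quiver. -/
structure HomGroupoid (x y : P.Obj) where
  cell : P.Cell1 x y

instance (x y : P.Obj) : Groupoid (HomGroupoid x y) where
  Hom u v := TCell u.cell v.cell
  id u := TCell.id u.cell
  comp := TCell.comp
  inv := TCell.inv
  id_comp := TCell.id_comp
  comp_id := TCell.comp_id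
  assoc := TCell.comp_assoc
  inv_comp := TCell.inv_comp
  comp_inv := TCell.comp_inv

namespace GlobularExtension

variable (Γ : GlobularExtension.{u, v, w, t} P) {x y : P.Obj} {u v w : P.Cell1 x y}

/-- The relation `≡_Γ` on the morphisms of `HomGroupoid x y`. -/
def homRel (x y : P.Obj) : HomRel (HomGroupoid x y) := fun _ _ => Γ.Equal

instance (x y : P.Obj) : Congruence (Γ.homRel x y) where
  equivalence := ⟨.refl, .symm, .trans⟩
  comp_left _ _ _ h := .comp (.refl _) h
  comp_right _ h := .comp h (.refl _)

/-- A `1`-cell as an object of the quotient of `HomGroupoid x y` by `≡_Γ`. -/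
abbrev obj (u : P.Cell1 x y) : CategoryTheory.Quotient (Γ.homRel x y) := ⟨⟨u⟩⟩

/-- The class modulo `≡_Γ` of a `2`-cell of the free `(2,1)`-category. -/
def toHom (f : TCell u v) : Γ.obj u ⟶ Γ.obj v :=
  (CategoryTheory.Quotient.functor (Γ.homRel x y)).map (X := ⟨u⟩) (Y := ⟨v⟩) f

theorem toHom_eq_iff {f g : TCell u v} : Γ.toHom f = Γ.toHom g ↔ Γ.Equal f g :=
  CategoryTheory.Quotient.functor_map_eq_iff (Γ.homRel x y) (X := ⟨u⟩) (Y := ⟨v⟩) f g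

@[simp]
theorem toHom_id : Γ.toHom (TCell.id u) = 𝟙 (Γ.obj u) :=
  (CategoryTheory.Quotient.functor (Γ.homRel x y)).map_id _

@[simp]
theorem toHom_comp (f : TCell u v) (g : TCell v w) :
    Γ.toHom (f.comp g) = Γ.toHom f ≫ Γ.toHom g :=
  (CategoryTheory.Quotient.functor (Γ.homRel x y)).map_comp (X := ⟨u⟩) (Y := ⟨v⟩) (Z := ⟨w⟩) f g

@[simp]
theorem toHom_inv (f : TCell u v) : Γ.toHom f.inv = inv (Γ.toHom f) :=
  IsIso.eq_inv_of_hom_inv_id (by rw [← toHom_comp, TCell.comp_inv, toHom_id])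

end GlobularExtension

namespace RSeq

variable {x y : P.Obj} {u v w : P.Cell1 x y}

theorem toTCell_nil (u : P.Cell1 x y) : (nil u).toTCell = TCell.id u := rfl

theorem toTCell_cons (f : Step u v) (s : RSeq v w) :
    (cons f s).toTCell = (TCell.step f).comp s.toTCell := rfl

theorem toTCell_append (r : RSeq u v) (s : RSeq v w) :
    (r.append s).toTCell = r.toTCell.comp s.toTCell := by
  induction r with
  | nil => exact (TCell.id_comp _).symm
  | cons f r ih => rw [append, toTCell_cons, toTCell_cons, ih, TCell.comp_assoc]

theorem toTCell_whiskerLeft {x' : P.Obj} (c : P.Cell1 x' x) (s : RSeq u v) :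
    (s.whiskerLeft c).toTCell = s.toTCell.whiskerLeft c := by
  induction s with
  | nil => rfl
  | cons f s ih => exact congrArg (TCell.comp (TCell.step (f.whiskerLeft c))) ih

theorem toTCell_whiskerRight {y' : P.Obj} (c : P.Cell1 y y') (s : RSeq u v) :
    (s.whiskerRight c).toTCell = s.toTCell.whiskerRight c := by
  induction s with
  | nil => rfl
  | cons f s ih => exact congrArg (TCell.comp (TCell.step (f.whiskerRight c))) ih

end RSeq

/-! ## Loops -/

namespace RSeq

variable {x y : P.Obj} {u v w : P.Cell1 x y}

/-- The number of rewriting steps of a rewriting sequence. -/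
def length {x y : P.Obj} {u v : P.Cell1 x y} : RSeq u v → ℕ
  | nil _ => 0
  | cons _ s => s.length + 1

theorem length_append (r : RSeq u v) (s : RSeq v w) :
    (r.append s).length = r.length + s.length := by
  induction r with
  | nil => exact (Nat.zero_add _).symm
  | cons f r ih => simp only [append, length, ih, Nat.add_right_comm]

theorem length_whiskerLeft {x' : P.Obj} (c : P.Cell1 x' x) (s : RSeq u v) :
    (s.whiskerLeft c).length = s.length := by
  induction s with
  | nil => rfl
  | cons f s ih => simp only [whiskerLeft, length, ih]

theorem length_whiskerRight {y' : P.Obj} (c : P.Cell1 y y') (s : RSeq u v) :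
    (s.whiskerRight c).length = s.length := by
  induction s with
  | nil => rfl
  | cons f s ih => simp only [whiskerRight, length, ih]

theorem Rel.length_eq {s s' : RSeq u v} (h : Rel s s') : s.length = s'.length := by
  induction h with
  | refl => rfl
  | symm _ ih => exact ih.symm
  | trans _ _ ih₁ ih₂ => exact ih₁.trans ih₂
  | cons f _ ih => simp only [length, ih]
  | peiffer => rfl

end RSeq

namespace Cell2

variable {x y : P.Obj} {u v w : P.Cell1 x y}

/-- The number of rewriting steps of a `2`-cell of the free `2`-category, which is well defined
because the Peiffer relations preserve it. -/
def length : Cell2 u v → ℕ := Quotient.lift RSeq.length fun _ _ h => RSeq.Rel.length_eq h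

theorem length_comp (f : Cell2 u v) (g : Cell2 v w) :
    (f.comp g).length = f.length + g.length := by
  induction f, g using Quotient.inductionOn₂
  exact RSeq.length_append _ _

theorem length_whiskerLeft {x' : P.Obj} (c : P.Cell1 x' x) (f : Cell2 u v) :
    (f.whiskerLeft c).length = f.length := by
  induction f using Quotient.inductionOn
  exact RSeq.length_whiskerLeft c _

theorem length_whiskerRight {y' : P.Obj} (c : P.Cell1 y y') (f : Cell2 u v) :
    (f.whiskerRight c).length = f.length := by
  induction f using Quotient.inductionOn
  exact RSeq.length_whiskerRight c _

theorem eq_of_length_eq_zero {f : Cell2 u v} (h : f.length = 0) : u = v := by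
  induction f using Quotient.inductionOn with | h s
  cases s with
  | nil => rfl
  | cons f s => exact absurd h (Nat.succ_ne_zero _)

theorem eq_id_of_length_eq_zero {f : Cell2 u u} (h : f.length = 0) : f = id u := by
  induction f using Quotient.inductionOn with | h s
  cases s with
  | nil => rfl
  | cons f s => exact absurd h (Nat.succ_ne_zero _)

theorem id_comp (f : Cell2 u v) : (id u).comp f = f := by
  induction f using Quotient.inductionOn
  rfl

theorem comp_id (f : Cell2 u v) : f.comp (id v) = f := by
  induction f using Quotient.inductionOn with | h s
  refine congrArg (Quotient.mk _) ?_
  induction s with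
  | nil => rfl
  | cons f s ih => exact congrArg (RSeq.cons f) ih

theorem toTCell_comp (f : Cell2 u v) (g : Cell2 v w) :
    (f.comp g).toTCell = f.toTCell.comp g.toTCell := by
  induction f, g using Quotient.inductionOn₂
  exact RSeq.toTCell_append _ _

theorem toTCell_whiskerLeft {x' : P.Obj} (c : P.Cell1 x' x) (f : Cell2 u v) :
    (f.whiskerLeft c).toTCell = f.toTCell.whiskerLeft c := by
  induction f using Quotient.inductionOn
  exact RSeq.toTCell_whiskerLeft c _

theorem toTCell_whiskerRight {y' : P.Obj} (c : P.Cell1 y y') (f : Cell2 u v) :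
    (f.whiskerRight c).toTCell = f.toTCell.whiskerRight c := by
  induction f using Quotient.inductionOn
  exact RSeq.toTCell_whiskerRight c _

end Cell2

namespace Loop

theorem exists_shorter_of_not_isMinimalComp {L : Loop P} (hL : ¬ L.IsMinimalComp) :
    ∃ (x y : P.Obj) (u v : P.Cell1 x y) (g : Cell2 u v) (h : Cell2 v v) (k : Cell2 v u),
      L = ⟨(g.comp h).comp k⟩ ∧ h.length < L.cell.length ∧
        (g.comp k).length < L.cell.length := by
  obtain ⟨f⟩ := L
  simp only [IsMinimalComp, not_forall, not_or] at hL
  obtain ⟨v, g, h, k, rfl, hid, hne⟩ := hL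
  have h_pos : h.length ≠ 0 := fun h₀ => hid (Cell2.eq_id_of_length_eq_zero h₀)
  have gk_pos : g.length + k.length ≠ 0 := by
    intro h₀
    obtain ⟨hg, hk⟩ := Nat.add_eq_zero_iff.1 h₀
    obtain rfl := Cell2.eq_of_length_eq_zero hg
    rw [Cell2.eq_id_of_length_eq_zero hg, Cell2.eq_id_of_length_eq_zero hk, Cell2.id_comp,
      Cell2.comp_id] at hne
    exact hne rfl
  refine ⟨_, _, _, v, g, h, k, rfl, ?_, ?_⟩ <;> simp only [Cell2.length_comp] <;> omega

theorem length_cell_whisker (L : Loop P) {x' y' : P.Obj} (c : P.Cell1 x' L.x)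
    (d : P.Cell1 L.y y') : (L.whisker c d).cell.length = L.cell.length :=
  (Cell2.length_whiskerRight d _).trans (Cell2.length_whiskerLeft c _)

theorem exists_shorter_of_not_isMinimalContext {L : Loop P} (hL : ¬ L.IsMinimalContext) :
    ∃ (L' : Loop P) (x' y' : P.Obj) (c : P.Cell1 x' L'.x) (d : P.Cell1 L'.y y'),
      L = L'.whisker c d ∧ L'.cell.length = L.cell.length ∧ L'.u.length < L.u.length := by
  simp only [IsMinimalContext, not_forall] at hL
  obtain ⟨L', x', y', c, d, rfl, hcd⟩ := hL
  refine ⟨L', x', y', c, d, rfl, (length_cell_whisker L' c d).symm, ?_⟩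
  simp only [whisker, Quiver.Path.length_comp]
  omega

@[elab_as_elim]
theorem induction_on_isElementary {motive : Loop P → Prop} (L : Loop P)
    (identity : ∀ {x y : P.Obj} (u : P.Cell1 x y), motive ⟨Cell2.id u⟩)
    (elementary : ∀ L : Loop P, L.IsElementary → motive L)
    (insert : ∀ {x y : P.Obj} {u v : P.Cell1 x y} (g : Cell2 u v) (h : Cell2 v v) (k : Cell2 v u),
      motive ⟨h⟩ → motive ⟨g.comp k⟩ → motive ⟨(g.comp h).comp k⟩)
    (whisker : ∀ (L : Loop P) {x' y' : P.Obj} (c : P.Cell1 x' L.x) (d : P.Cell1 L.y y'),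
      motive L → motive (L.whisker c d)) : motive L := by
  by_cases hcomp : L.IsMinimalComp
  · by_cases hcontext : L.IsMinimalContext
    · by_cases hid : L.IsIdentity
      · obtain ⟨f⟩ := L
        obtain rfl : f = Cell2.id _ := hid
        exact identity _
      · exact elementary L ⟨hid, hcomp, hcontext⟩
    · obtain ⟨L', x', y', c, d, hL, hcell, hu⟩ := exists_shorter_of_not_isMinimalContext hcontext
      exact hL ▸ whisker L' c d (induction_on_isElementary L' identity elementary insert whisker)
  · obtain ⟨x, y, u, v, g, h, k, hL, hh, hgk⟩ := exists_shorter_of_not_isMinimalComp hcomp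
    exact hL ▸ insert g h k (induction_on_isElementary ⟨h⟩ identity elementary insert whisker)
      (induction_on_isElementary ⟨g.comp k⟩ identity elementary insert whisker)
termination_by (L.cell.length, L.u.length)
decreasing_by
  · exact Prod.Lex.right' _ hcell.le hu
  · exact Prod.Lex.left _ _ hh
  · exact Prod.Lex.left _ _ hgk

end Loop

namespace GlobularExtension

variable (Γ : GlobularExtension.{u, v, w, t} P)

/-- `L` is trivial modulo `≡_Γ`. -/
def Trivializes (L : Loop P) : Prop := Γ.Equal L.cell.toTCell (TCell.id L.u)

variable {Γ}

theorem trivializes_iff_toHom_eq_id {L : Loop P} :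
    Γ.Trivializes L ↔ Γ.toHom L.cell.toTCell = 𝟙 (Γ.obj L.u) := by
  rw [Trivializes, ← toHom_eq_iff, toHom_id]

theorem trivializes_iff_of_rotation {L L' : Loop P} (h : Loop.Rotation L L') :
    Γ.Trivializes L ↔ Γ.Trivializes L' := by
  obtain ⟨f, g⟩ := h
  simp only [trivializes_iff_toHom_eq_id, Cell2.toTCell_comp, toHom_comp]
  exact (hom_comp_eq_id _).trans (comp_hom_eq_id _).symm

theorem trivializes_iff_of_equivalence {L L' : Loop P} (h : Loop.equivalence P L L') :
    Γ.Trivializes L ↔ Γ.Trivializes L' := by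
  induction h with
  | rel _ _ h => exact trivializes_iff_of_rotation h
  | refl => rfl
  | symm _ _ _ ih => exact ih.symm
  | trans _ _ _ _ _ ih₁ ih₂ => exact ih₁.trans ih₂

theorem Trivializes.whisker {L : Loop P} (h : Γ.Trivializes L) {x' y' : P.Obj}
    (c : P.Cell1 x' L.x) (d : P.Cell1 L.y y') : Γ.Trivializes (L.whisker c d) := by
  unfold Trivializes Loop.whisker
  rw [Cell2.toTCell_whiskerRight, Cell2.toTCell_whiskerLeft]
  exact .whiskerRight d (.whiskerLeft c h)

theorem trivializes_of_forall_isElementary (hΓ : ∀ L : Loop P, L.IsElementary → Γ.Trivializes L)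
    (L : Loop P) : Γ.Trivializes L := by
  induction L using Loop.induction_on_isElementary with
  | identity u => exact .refl _
  | elementary L hL => exact hΓ L hL
  | insert g h k hh hgk =>
    rw [trivializes_iff_toHom_eq_id] at hh hgk ⊢
    simp only [Cell2.toTCell_comp, toHom_comp] at hh hgk ⊢
    rw [hh, Category.comp_id, hgk]
  | whisker L c d hL => exact hL.whisker c d

end GlobularExtension

theorem StrictSquierCompletion.trivializes {W : Type t} [PartialOrder W] {ψ : P.Labelling W}
    (S : StrictSquierCompletion ψ) (L : Loop P) : S.extension.Trivializes L := by
  refine GlobularExtension.trivializes_of_forall_isElementary (fun L hL => ?_) L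
  let c : P.ElementaryLoopClass := ⟨Quotient.mk _ L, L, hL, rfl⟩
  have hc : Loop.equivalence P (S.loop c) L := Quotient.exact (S.loop_class c)
  exact (GlobularExtension.trivializes_iff_of_equivalence hc).1 (.gen (Γ := S.extension) (.inr c))

/-! ## Coherent local branchings -/

/-- The rule applied by a rewriting step, with the `1`-cells on its left and on its right. Bundling
their endpoints makes steps between different `1`-cells comparable. -/
def Step.components {x y : P.Obj} {u v : P.Cell1 x y} (f : Step u v) :
    P.AllRules × (Σ a b : P.Obj, P.Cell1 a b) × (Σ a b : P.Obj, P.Cell1 a b) :=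
  (⟨_, _, _, _, f.φ⟩, ⟨_, _, f.l⟩, ⟨_, _, f.r⟩)

theorem PeifferSquare.of_whisker {x y z : P.Obj} {u u' : P.Cell1 x y} {v v' : P.Cell1 y z}
    (f : Step u u') (g : Step v v') :
    PeifferSquare (f.whiskerRight v) (g.whiskerLeft u') (g.whiskerLeft u) (f.whiskerRight v') := by
  obtain ⟨l, φ, r, rfl, rfl⟩ := f
  obtain ⟨l', χ, r', rfl, rfl⟩ := g
  exact .mk l φ (r.comp l') χ r' (by simp) (by simp) (by simp) (by simp) _ _ _ _ _ _ _ _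

namespace LocalBranching

theorem eq_of_components_eq {b b' : LocalBranching P} (hf : b.f.components = b'.f.components)
    (hg : b.g.components = b'.g.components) : b = b' := by
  obtain ⟨⟨l₁, φ, r₁, rfl, rfl⟩, ⟨l₂, χ, r₂, s₂, rfl⟩⟩ := b
  obtain ⟨⟨l₁', φ', r₁', rfl, rfl⟩, ⟨l₂', χ', r₂', s₂', rfl⟩⟩ := b'
  cases hf
  cases hg
  rfl

theorem whisker_nil_nil (b : LocalBranching P) : b.whisker .nil .nil = b :=
  eq_of_components_eq (by simp [whisker, Step.whiskerLeft, Step.whiskerRight, Step.components])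
    (by simp [whisker, Step.whiskerLeft, Step.whiskerRight, Step.components])

theorem exists_shorter_of_not_isCritical {b : LocalBranching P} (ho : b.IsOverlapping)
    (hc : ¬ b.IsCritical) :
    ∃ (b' : LocalBranching P) (x' y' : P.Obj) (c : P.Cell1 x' b'.x) (d : P.Cell1 b'.y y'),
      b = b'.whisker c d ∧ b'.u.length < b.u.length := by
  simp only [IsCritical, not_and, not_forall] at hc
  obtain ⟨b', ⟨x', y', c, d, rfl⟩, hsub⟩ := hc ho
  refine ⟨b', x', y', c, d, rfl, ?_⟩
  by_contra hlt
  simp only [whisker, Quiver.Path.length_comp] at hlt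
  obtain rfl := c.eq_of_length_zero (by omega)
  obtain rfl := d.eq_of_length_zero (by omega)
  obtain rfl := c.eq_nil_of_length_zero (by omega)
  obtain rfl := d.eq_nil_of_length_zero (by omega)
  exact hsub ⟨_, _, .nil, .nil, by simp only [whisker_nil_nil]⟩

@[elab_as_elim]
theorem induction_on_isCritical {motive : LocalBranching P → Prop} (b : LocalBranching P)
    (aspherical : ∀ {x y : P.Obj} {u v : P.Cell1 x y} (f : Step u v), motive ⟨f, f⟩)
    (peiffer : ∀ {x y z : P.Obj} {u u' : P.Cell1 x y} {v v' : P.Cell1 y z} (f : Step u u')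
      (g : Step v v'), motive ⟨f.whiskerRight v, g.whiskerLeft u⟩)
    (critical : ∀ b : LocalBranching P, b.IsCritical → motive b)
    (swap : ∀ b : LocalBranching P, motive b → motive b.swap)
    (whisker : ∀ (b : LocalBranching P) {x' y' : P.Obj} (c : P.Cell1 x' b.x) (d : P.Cell1 b.y y'),
      motive b → motive (b.whisker c d)) : motive b := by
  by_cases ha : b.IsAspherical
  · exact ha ▸ aspherical b.f
  by_cases hp : b.IsPeiffer
  · obtain ⟨x, y, z, u, u', v, v', f, g, rfl | rfl⟩ := hp
    · exact peiffer f g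
    · exact swap _ (peiffer f g)
  by_cases hc : b.IsCritical
  · exact critical b hc
  · obtain ⟨b', x', y', c, d, hb, hlt⟩ := exists_shorter_of_not_isCritical ⟨ha, hp⟩ hc
    exact hb ▸ whisker b' c d
      (induction_on_isCritical b' aspherical peiffer critical swap whisker)
termination_by b.u.length

end LocalBranching

/-- The local branching `b` has a strictly decreasing confluence diagram that commutes modulo
`≡_Γ`. -/
def Labelling.HasCoherentDiagram {W : Type*} [PartialOrder W] (ψ : P.Labelling W)
    (Γ : GlobularExtension.{u, v, w, t} P) (b : LocalBranching P) : Prop :=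
  ∃ (z : P.Cell1 b.x b.y) (f' : RSeq b.v z) (g' : RSeq b.w z), ψ.IsStrictDiagram b.f b.g f' g' ∧
    Γ.Equal ((TCell.step b.f).comp f'.toTCell) ((TCell.step b.g).comp g'.toTCell)

namespace Labelling.HasCoherentDiagram

variable {W : Type*} [PartialOrder W] {ψ : P.Labelling W} {Γ : GlobularExtension.{u, v, w, t} P}

theorem swap {b : LocalBranching P} (h : ψ.HasCoherentDiagram Γ b) :
    ψ.HasCoherentDiagram Γ b.swap := by
  obtain ⟨z, f', g', hstrict, heq⟩ := h
  exact ⟨z, g', f', hstrict.symm, heq.symm⟩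

theorem whisker {b : LocalBranching P} (h : ψ.HasCoherentDiagram Γ b)
    (hctx : ψ.IsCompatibleWithContexts) {x' y' : P.Obj} (c : P.Cell1 x' b.x)
    (d : P.Cell1 b.y y') : ψ.HasCoherentDiagram Γ (b.whisker c d) := by
  obtain ⟨z, f', g', hstrict, heq⟩ := h
  have whisker_cons : ∀ {v : P.Cell1 b.x b.y} (f : Step b.u v) (s : RSeq v z),
      (((TCell.step f).comp s.toTCell).whiskerLeft c).whiskerRight d =
        (RSeq.cons ((f.whiskerLeft c).whiskerRight d)
          ((s.whiskerLeft c).whiskerRight d)).toTCell := fun f s => by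
    rw [← RSeq.toTCell_cons, ← RSeq.toTCell_whiskerLeft, ← RSeq.toTCell_whiskerRight]
    rfl
  refine ⟨_, _, _, hctx _ _ _ _ hstrict c d, ?_⟩
  have heq' := (heq.whiskerLeft c).whiskerRight d
  rwa [whisker_cons, whisker_cons] at heq'

theorem of_same {x y : P.Obj} {u v : P.Cell1 x y} (f : Step u v) :
    ψ.HasCoherentDiagram Γ ⟨f, f⟩ :=
  ⟨v, .nil v, .nil v, ⟨fun _ h => h.elim, fun _ h => h.elim⟩, .refl _⟩

theorem of_peiffer (hp : ψ.IsPeifferDecreasing Γ) {x y z : P.Obj} {u u' : P.Cell1 x y}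
    {v v' : P.Cell1 y z} (f : Step u u') (g : Step v v') :
    ψ.HasCoherentDiagram Γ ⟨f.whiskerRight v, g.whiskerLeft u⟩ := by
  obtain ⟨c, f', g', hstrict, heq⟩ := hp f g
  refine ⟨c, f', g', hstrict, ?_⟩
  have square := congrArg Γ.toHom (TCell.step_comp_step_of_peifferSquare (.of_whisker f g))
  rw [← Γ.toHom_eq_iff] at heq ⊢
  simp only [GlobularExtension.toHom_comp, GlobularExtension.toHom_inv] at heq square ⊢
  rw [IsIso.eq_comp_inv, Category.assoc] at heq
  rw [← heq, ← Category.assoc, square, Category.assoc, IsIso.hom_inv_id_assoc]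

end Labelling.HasCoherentDiagram

theorem StrictSquierCompletion.hasCoherentDiagram {W : Type t} [PartialOrder W]
    {ψ : P.Labelling W} (S : StrictSquierCompletion ψ) (hctx : ψ.IsCompatibleWithContexts)
    (hp : ψ.IsPeifferDecreasing S.extension) (b : LocalBranching P) :
    ψ.HasCoherentDiagram S.extension b := by
  induction b using LocalBranching.induction_on_isCritical with
  | aspherical f => exact .of_same f
  | peiffer f g => exact .of_peiffer hp f g
  | critical b hb =>
    have of_mem_crit : ∀ b ∈ S.crit, ψ.HasCoherentDiagram S.extension b := fun b hb =>
      ⟨_, _, _, S.strict ⟨b, hb⟩, .gen (Γ := S.extension) (.inl ⟨b, hb⟩)⟩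
    exact (S.covers b hb).elim (of_mem_crit b) fun h => (of_mem_crit _ h).swap
  | swap b ih => exact ih.swap
  | whisker b c d ih => exact ih.whisker hctx c d

/-! ## Decreasing diagrams -/

section DecreasingDiagrams

variable {W : Type*} (ψ : P.Labelling W) (Γ : GlobularExtension.{u, v, w, t} P) {x y : P.Obj}
  {u v w : P.Cell1 x y}

/-- The labels of the steps of a rewriting sequence, with multiplicities. -/
def Labelling.labelMultiset {x y : P.Obj} {u v : P.Cell1 x y} : RSeq u v → Multiset W
  | .nil _ => 0
  | .cons f s => ψ f ::ₘ labelMultiset s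

theorem Labelling.mem_labelMultiset {s : RSeq u v} {k : W} :
    k ∈ ψ.labelMultiset s ↔ k ∈ ψ.labels s := by
  induction s with
  | nil => simp [labelMultiset, labels]
  | cons f s ih => simp [labelMultiset, labels, ih]

theorem Labelling.labelMultiset_append (r : RSeq u v) (s : RSeq v w) :
    ψ.labelMultiset (r.append s) = ψ.labelMultiset r + ψ.labelMultiset s := by
  induction r with
  | nil => simp [RSeq.append, labelMultiset]
  | cons f r ih => simp [RSeq.append, labelMultiset, ih]

/-- `φ` is the class modulo `≡_Γ` of a conversion, that is a zigzag of rewriting steps, and `M` is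
the multiset of the labels of these steps. -/
inductive IsConversion :
    {u v : P.Cell1 x y} → Multiset W → (Γ.obj u ⟶ Γ.obj v) → Prop
  | nil (u : P.Cell1 x y) : IsConversion 0 (𝟙 (Γ.obj u))
  | forward {u v w : P.Cell1 x y} {M : Multiset W} {φ : Γ.obj v ⟶ Γ.obj w} (f : Step u v) :
      IsConversion M φ → IsConversion (ψ f ::ₘ M) (Γ.toHom (.step f) ≫ φ)
  | backward {u v w : P.Cell1 x y} {M : Multiset W} {φ : Γ.obj u ⟶ Γ.obj w} (f : Step u v) :
      IsConversion M φ → IsConversion (ψ f ::ₘ M) (inv (Γ.toHom (.step f)) ≫ φ)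

/-- `φ` is the class modulo `≡_Γ` of a rewriting sequence followed by the inverse of another one,
and `M` is the multiset of the labels of their steps. -/
def IsValley (M : Multiset W) (φ : Γ.obj u ⟶ Γ.obj v) : Prop :=
  ∃ (z : P.Cell1 x y) (p : RSeq u z) (q : RSeq v z),
    φ = Γ.toHom p.toTCell ≫ inv (Γ.toHom q.toTCell) ∧ M = ψ.labelMultiset p + ψ.labelMultiset q

/-- `φ` is the class modulo `≡_Γ` of a conversion that contains a local peak `f⁻ ⋆₁ g`, and `M` is
the multiset of the labels of its steps. -/
def HasLocalPeak (M : Multiset W) (φ : Γ.obj u ⟶ Γ.obj v) : Prop :=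
  ∃ (a b c : P.Cell1 x y) (f : Step a b) (g : Step a c) (M₁ M₂ : Multiset W)
    (α : Γ.obj u ⟶ Γ.obj b) (β : Γ.obj c ⟶ Γ.obj v),
    IsConversion ψ Γ M₁ α ∧ IsConversion ψ Γ M₂ β ∧
      φ = α ≫ (inv (Γ.toHom (.step f)) ≫ Γ.toHom (.step g)) ≫ β ∧ M = M₁ + {ψ f, ψ g} + M₂

variable {ψ Γ} {M N : Multiset W}

namespace IsConversion

theorem comp {φ : Γ.obj u ⟶ Γ.obj v} {χ : Γ.obj v ⟶ Γ.obj w} (hφ : IsConversion ψ Γ M φ)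
    (hχ : IsConversion ψ Γ N χ) : IsConversion ψ Γ (M + N) (φ ≫ χ) := by
  induction hφ with
  | nil u => simpa only [zero_add, Category.id_comp] using hχ
  | forward f _ ih => simpa only [Multiset.cons_add, Category.assoc] using (ih hχ).forward f
  | backward f _ ih => simpa only [Multiset.cons_add, Category.assoc] using (ih hχ).backward f

theorem step (f : Step u v) : IsConversion ψ Γ {ψ f} (Γ.toHom (.step f)) := by
  simpa using (nil v).forward f

theorem inv_step (f : Step u v) : IsConversion ψ Γ {ψ f} (inv (Γ.toHom (.step f))) := by
  simpa using (nil u).backward f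

theorem inv {φ : Γ.obj u ⟶ Γ.obj v} (hφ : IsConversion ψ Γ M φ) :
    IsConversion ψ Γ M (inv φ) := by
  induction hφ with
  | nil u => simpa using nil u
  | forward f _ ih =>
    simpa only [IsIso.inv_comp, ← Multiset.singleton_add, add_comm] using ih.comp (inv_step f)
  | backward f _ ih =>
    simpa only [IsIso.inv_comp, IsIso.inv_inv, ← Multiset.singleton_add, add_comm] using
      ih.comp (step f)

theorem of_rSeq (s : RSeq u v) :
    IsConversion ψ Γ (ψ.labelMultiset s) (Γ.toHom s.toTCell) := by
  induction s with
  | nil u => exact Γ.toHom_id (u := u) ▸ nil u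
  | cons f s ih =>
    rw [RSeq.toTCell_cons, Γ.toHom_comp]
    exact ih.forward f

theorem exists_of_tCell (f : TCell u v) : ∃ M, IsConversion ψ Γ M (Γ.toHom f) := by
  induction f using Quotient.inductionOn with | h s
  induction s with
  | id u => exact ⟨0, nil u⟩
  | step f => exact ⟨_, step f⟩
  | comp f g ihf ihg =>
    obtain ⟨M, hM⟩ := ihf
    obtain ⟨N, hN⟩ := ihg
    exact ⟨M + N, Γ.toHom_comp (Quotient.mk _ f) (Quotient.mk _ g) ▸ hM.comp hN⟩
  | inv f ih =>
    obtain ⟨M, hM⟩ := ih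
    exact ⟨M, Γ.toHom_inv (Quotient.mk _ f) ▸ hM.inv⟩

end IsConversion

theorem HasLocalPeak.comp_left {φ : Γ.obj u ⟶ Γ.obj v} {χ : Γ.obj v ⟶ Γ.obj w}
    (hφ : IsConversion ψ Γ M φ) (hχ : HasLocalPeak ψ Γ N χ) :
    HasLocalPeak ψ Γ (M + N) (φ ≫ χ) := by
  obtain ⟨a, b, c, f, g, M₁, M₂, α, β, hα, hβ, rfl, rfl⟩ := hχ
  exact ⟨a, b, c, f, g, M + M₁, M₂, φ ≫ α, β, hφ.comp hα, hβ, by simp, by simp [add_assoc]⟩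

theorem IsConversion.isValley_or_hasLocalPeak {φ : Γ.obj u ⟶ Γ.obj v}
    (hφ : IsConversion ψ Γ M φ) : IsValley ψ Γ M φ ∨ HasLocalPeak ψ Γ M φ := by
  induction hφ with
  | nil u => exact .inl ⟨u, .nil u, .nil u, by simp [RSeq.toTCell_nil], rfl⟩
  | forward f _ ih =>
    obtain ⟨z, p, q, rfl, rfl⟩ | hpeak := ih
    · exact .inl ⟨z, .cons f p, q, by simp [RSeq.toTCell_cons],
        by simp [Labelling.labelMultiset]⟩
    · exact .inr (hpeak.comp_left (step f))
  | backward f _ ih =>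
    obtain ⟨z, p, q, rfl, rfl⟩ | hpeak := ih
    · cases p with
      | nil =>
        refine .inl ⟨_, .nil _, q.append (.cons f (.nil _)), ?_, ?_⟩
        · simp [RSeq.toTCell_append, RSeq.toTCell_cons, RSeq.toTCell_nil]
        · rw [ψ.labelMultiset_append, add_comm (ψ.labelMultiset q)]
          simp [Labelling.labelMultiset]
      | cons g p =>
        refine .inr ⟨_, _, _, f, g, 0, _, 𝟙 _, _, .nil _,
          (of_rSeq p).comp (of_rSeq q).inv, ?_, ?_⟩
        · simp [RSeq.toTCell_cons]
        · simp [Labelling.labelMultiset]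
    · exact .inr (hpeak.comp_left (inv_step f))

variable [PartialOrder W]

theorem isDershowitzMannaLT_replace_peak {k l : W} {M₁ M₂ K L : Multiset W}
    (hK : ∀ i ∈ K, i < k) (hL : ∀ i ∈ L, i < l) :
    (M₁ + (K + L) + M₂).IsDershowitzMannaLT (M₁ + {k, l} + M₂) := by
  refine ⟨M₁ + M₂, K + L, {k, l}, by simp, add_right_comm _ _ _, add_right_comm _ _ _,
    fun i hi => ?_⟩
  obtain hi | hi := Multiset.mem_add.1 hi
  · exact ⟨k, by simp, hK i hi⟩
  · exact ⟨l, by simp, hL i hi⟩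

theorem HasLocalPeak.exists_isConversion_lt (hcoh : ∀ b, ψ.HasCoherentDiagram Γ b)
    {φ : Γ.obj u ⟶ Γ.obj v} (hφ : HasLocalPeak ψ Γ M φ) :
    ∃ N, N.IsDershowitzMannaLT M ∧ IsConversion ψ Γ N φ := by
  obtain ⟨a, b, c, f, g, M₁, M₂, α, β, hα, hβ, rfl, rfl⟩ := hφ
  obtain ⟨z, f', g', ⟨hf', hg'⟩, heq⟩ := hcoh ⟨f, g⟩
  have peak_eq_valley : inv (Γ.toHom (.step f)) ≫ Γ.toHom (.step g) =
      Γ.toHom f'.toTCell ≫ inv (Γ.toHom g'.toTCell) := by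
    rw [← Γ.toHom_eq_iff, Γ.toHom_comp, Γ.toHom_comp] at heq
    rw [IsIso.inv_comp_eq, ← Category.assoc, IsIso.eq_comp_inv, heq]
  rw [peak_eq_valley, ← Category.assoc]
  exact ⟨_, isDershowitzMannaLT_replace_peak (fun i hi => hf' i (ψ.mem_labelMultiset.1 hi))
    (fun i hi => hg' i (ψ.mem_labelMultiset.1 hi)),
    (hα.comp ((IsConversion.of_rSeq f').comp (IsConversion.of_rSeq g').inv)).comp hβ⟩

variable [WellFoundedLT W]

theorem IsConversion.exists_isValley (hcoh : ∀ b, ψ.HasCoherentDiagram Γ b)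
    {φ : Γ.obj u ⟶ Γ.obj v} (hφ : IsConversion ψ Γ M φ) : ∃ N, IsValley ψ Γ N φ := by
  induction Multiset.wellFounded_isDershowitzMannaLT.apply M with | intro M _ ih
  obtain hvalley | hpeak := hφ.isValley_or_hasLocalPeak
  · exact ⟨M, hvalley⟩
  · obtain ⟨N, hlt, hN⟩ := hpeak.exists_isConversion_lt hcoh
    exact ih N hlt hN

theorem exists_equal_comp_inv (hcoh : ∀ b, ψ.HasCoherentDiagram Γ b) (f : TCell u v) :
    ∃ (z : P.Cell1 x y) (p : RSeq u z) (q : RSeq v z),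
      Γ.Equal f (p.toTCell.comp q.toTCell.inv) := by
  obtain ⟨M, hM⟩ := IsConversion.exists_of_tCell (ψ := ψ) (Γ := Γ) f
  obtain ⟨N, z, p, q, heq, -⟩ := hM.exists_isValley hcoh
  exact ⟨z, p, q, Γ.toHom_eq_iff.1 (by rw [heq, Γ.toHom_comp, Γ.toHom_inv])⟩

end DecreasingDiagrams

/-! ## Quasi-normal forms -/

section QuasiNormalForms

variable {x y : P.Obj} {u v w : P.Cell1 x y}

/-- The quasi-normal forms: the `1`-cells `u` such that whatever `u` rewrites into rewrites back
into `u`. -/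
def IsQuasiNormal (u : P.Cell1 x y) : Prop :=
  ∀ v : P.Cell1 x y, Nonempty (RSeq u v) → Nonempty (RSeq v u)

/-- Every `1`-cell rewrites into a quasi-normal form. -/
def IsQuasiNormalizing (P : TwoPolygraph.{u, v, w}) : Prop :=
  ∀ {x y : P.Obj} (u : P.Cell1 x y), ∃ v : P.Cell1 x y, Nonempty (RSeq u v) ∧ IsQuasiNormal v

/-- The length of a shortest rewriting sequence from `u` to a `1`-cell that does not rewrite into
`u`. If there is none, that is if `u` is a quasi-normal form, then the value is `0`. -/
noncomputable def exitDist (u : P.Cell1 x y) : ℕ :=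
  sInf {n | ∃ (z : P.Cell1 x y) (s : RSeq u z), s.length = n ∧ IsEmpty (RSeq z u)}

/-- `u` rewrites into `v`, and if `v` rewrites into `u` then `v` is closer to an exit. -/
def Descends (u v : P.Cell1 x y) : Prop :=
  Nonempty (RSeq u v) ∧ (Nonempty (RSeq v u) → exitDist v < exitDist u)

theorem not_descends_self (u : P.Cell1 x y) : ¬ Descends u u :=
  fun h => lt_irrefl _ (h.2 ⟨.nil u⟩)

instance : IsTrans (P.Cell1 x y) Descends where
  trans := by
    rintro u v w ⟨⟨r⟩, hr⟩ ⟨⟨s⟩, hs⟩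
    exact ⟨⟨r.append s⟩, fun ⟨t⟩ => (hs ⟨t.append r⟩).trans (hr ⟨s.append t⟩)⟩

theorem exists_step_descends_of_not_isQuasiNormal (hu : ¬ IsQuasiNormal u) :
    ∃ v, Nonempty (Step u v) ∧ Descends u v := by
  simp only [IsQuasiNormal, not_forall, not_nonempty_iff] at hu
  obtain ⟨z₀, ⟨s₀⟩, hz₀⟩ := hu
  obtain ⟨z, s, hs, hz⟩ : exitDist u ∈ _ := Nat.sInf_mem ⟨s₀.length, z₀, s₀, rfl, hz₀⟩
  cases s with
  | nil => exact hz.elim (.nil u)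
  | @cons _ v _ f s =>
    refine ⟨v, ⟨f⟩, ⟨.cons f (.nil v)⟩, fun ⟨r⟩ => ?_⟩
    have hzv : IsEmpty (RSeq z v) := ⟨fun t => hz.false (t.append r)⟩
    have hle : exitDist v ≤ s.length := Nat.sInf_le ⟨z, s, rfl, hzv⟩
    exact hle.trans_lt (hs ▸ Nat.lt_succ_self s.length)

theorem IsQuasiTerminating.wellFounded_step_and_descends (hq : P.IsQuasiTerminating) :
    WellFounded fun v u : P.Cell1 x y => Nonempty (Step u v) ∧ Descends u v := by
  refine wellFounded_iff_isEmpty_descending_chain.2 ⟨fun ⟨a, ha⟩ => ?_⟩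
  obtain ⟨c, hc⟩ := hq a fun n => (ha n).1
  obtain ⟨m, hm⟩ := hc.nonempty
  obtain ⟨n, hn, hmn⟩ := hc.exists_gt m
  have hdesc : Descends (a m) (a n) := Nat.rel_of_forall_rel_succ_of_lt _ (fun k => (ha k).2) hmn
  rw [show a m = c from hm, show a n = c from hn] at hdesc
  exact not_descends_self c hdesc

theorem IsQuasiTerminating.isQuasiNormalizing (hq : P.IsQuasiTerminating) :
    P.IsQuasiNormalizing := by
  intro x y u
  induction u using hq.wellFounded_step_and_descends.induction with | _ u ih
  by_cases hu : IsQuasiNormal u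
  · exact ⟨u, ⟨.nil u⟩, hu⟩
  · obtain ⟨v, ⟨f⟩, hdesc⟩ := exists_step_descends_of_not_isQuasiNormal hu
    obtain ⟨z, ⟨s⟩, hz⟩ := ih v ⟨⟨f⟩, hdesc⟩
    exact ⟨z, ⟨.cons f s⟩, hz⟩

end QuasiNormalForms

section HomotopyBasis

variable {Γ : GlobularExtension.{u, v, w, t} P} {x y : P.Obj} {u v : P.Cell1 x y}

theorem GlobularExtension.Trivializes.toHom_rSeq {s : RSeq u u}
    (h : Γ.Trivializes ⟨Quotient.mk _ s⟩) : Γ.toHom s.toTCell = 𝟙 (Γ.obj u) :=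
  trivializes_iff_toHom_eq_id.1 h

variable {W : Type*} [PartialOrder W] [WellFoundedLT W] {ψ : P.Labelling W}

theorem toHom_rSeq_eq (hq : P.IsQuasiNormalizing) (hloop : ∀ L, Γ.Trivializes L)
    (hcoh : ∀ b, ψ.HasCoherentDiagram Γ b) (r s : RSeq u v) :
    Γ.toHom r.toTCell = Γ.toHom s.toTCell := by
  obtain ⟨n, ⟨t⟩, hn⟩ := hq v
  obtain ⟨z, g, h, hgh⟩ := exists_equal_comp_inv hcoh
    ((r.append t).toTCell.inv.comp (s.append t).toTCell)
  obtain ⟨k⟩ := hn z ⟨g⟩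
  have valley_trivial : Γ.toHom g.toTCell = Γ.toHom h.toTCell := by
    have closed : Γ.toHom (g.append k).toTCell = Γ.toHom (h.append k).toTCell :=
      (hloop _).toHom_rSeq.trans (hloop _).toHom_rSeq.symm
    simpa only [RSeq.toTCell_append, Γ.toHom_comp, cancel_mono] using closed
  rw [← Γ.toHom_eq_iff] at hgh
  simp only [RSeq.toTCell_append, Γ.toHom_comp, Γ.toHom_inv, valley_trivial, IsIso.hom_inv_id,
    IsIso.inv_comp_eq, Category.comp_id, cancel_mono] at hgh
  exact hgh.symm

theorem equal_of_forall_hasCoherentDiagram (hq : P.IsQuasiNormalizing)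
    (hloop : ∀ L, Γ.Trivializes L) (hcoh : ∀ b, ψ.HasCoherentDiagram Γ b) (f g : TCell u v) :
    Γ.Equal f g := by
  obtain ⟨z, r, s, hrs⟩ := exists_equal_comp_inv hcoh (f.comp g.inv)
  rw [← Γ.toHom_eq_iff] at hrs ⊢
  rwa [Γ.toHom_comp, Γ.toHom_comp, Γ.toHom_inv, Γ.toHom_inv, toHom_rSeq_eq hq hloop hcoh r s,
    IsIso.hom_inv_id, IsIso.comp_inv_eq, Category.id_comp] at hrs

theorem GlobularExtension.isHomotopyBasis_of_forall_equal
    (h : ∀ {x y : P.Obj} {u v : P.Cell1 x y} (f g : TCell u v), Γ.Equal f g) :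
    Γ.IsHomotopyBasis := by
  have nonempty_cell3 : ∀ {x y : P.Obj} {u v : P.Cell1 x y} {f g : TCell u v},
      Γ.Equal f g → Nonempty (Γ.Cell3 f g) := by
    intro x y u v f g h
    induction h with
    | gen A => exact ⟨.gen A⟩
    | refl f => exact ⟨.id f⟩
    | symm _ ih => exact ih.map .inv
    | trans _ _ ih₁ ih₂ => exact ih₁.map2 .comp₂ ih₂
    | comp _ _ ih₁ ih₂ => exact ih₁.map2 .comp₁ ih₂
    | whiskerLeft c _ ih => exact ih.map (.whiskerLeft c)
    | whiskerRight c _ ih => exact ih.map (.whiskerRight c)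
  exact fun S => nonempty_cell3 (h S.src S.tgt)

theorem StrictSquierCompletion.isHomotopyBasis {W : Type t} [PartialOrder W] [WellFoundedLT W]
    {ψ : P.Labelling W} (S : StrictSquierCompletion ψ) (hq : P.IsQuasiNormalizing)
    (hctx : ψ.IsCompatibleWithContexts) (hp : ψ.IsPeifferDecreasing S.extension) :
    S.extension.IsHomotopyBasis :=
  GlobularExtension.isHomotopyBasis_of_forall_equal
    (equal_of_forall_hasCoherentDiagram hq S.trivializes (S.hasCoherentDiagram hctx hp))

end HomotopyBasis

/-! ## Finiteness of the critical branchings -/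

section Infixes

open Quiver

variable {V : Type*} [Quiver V]

theorem exists_eq_comp_of_comp_eq_comp {a b c d : V} {p : Path a b} {q : Path b d} {p' : Path a c}
    {q' : Path c d} (h : p.comp q = p'.comp q') (hle : p.length ≤ p'.length) :
    ∃ m : Path b c, p' = p.comp m ∧ q = m.comp q' := by
  induction q' with
  | nil => exact ⟨q, h.symm, rfl⟩
  | cons q' e ih =>
    cases q with
    | nil =>
      have hlen := congrArg Path.length h
      simp only [Path.comp_nil, Path.length_comp, Path.length_cons] at hlen
      omega
    | cons q e' =>
      obtain rfl := Path.obj_eq_of_cons_eq_cons h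
      obtain rfl := eq_of_heq (Path.hom_heq_of_cons_eq_cons h)
      obtain ⟨m, rfl, rfl⟩ := ih (eq_of_heq (Path.heq_of_cons_eq_cons h))
      exact ⟨m, rfl, rfl⟩

/-- The paths `c` such that `p = l c r` for some paths `l` and `r`, bundled with their endpoints. -/
def infixes {a b : V} (p : Path a b) : Set (Σ c d : V, Path c d) :=
  {c | ∃ (l : Path a c.1) (r : Path c.2.1 b), (l.comp c.2.2).comp r = p}

/-- The paths `c` such that `p = l c` for some path `l`, bundled with their source. -/
def suffixes {a b : V} (p : Path a b) : Set (Σ c : V, Path c b) :=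
  {c | ∃ l : Path a c.1, l.comp c.2 = p}

theorem finite_suffixes {a b : V} (p : Path a b) : (suffixes p).Finite := by
  induction p with
  | nil =>
    refine (Set.finite_singleton ⟨a, .nil⟩).subset ?_
    rintro ⟨c, _ | _⟩ ⟨l, hl⟩
    · rfl
    · cases hl
  | cons p e ih =>
    refine ((ih.image fun c => ⟨c.1, c.2.cons e⟩).insert ⟨_, .nil⟩).subset ?_
    rintro ⟨c, _ | ⟨q, e'⟩⟩ ⟨l, hl⟩
    · exact .inl rfl
    · cases hl
      exact .inr ⟨⟨c, q⟩, ⟨l, rfl⟩, rfl⟩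

theorem finite_infixes {a b : V} (p : Path a b) : (infixes p).Finite := by
  induction p with
  | nil =>
    refine (Set.finite_singleton ⟨a, a, .nil⟩).subset ?_
    rintro ⟨c, d, _ | _⟩ ⟨l, _ | _, h⟩ <;> cases h
    rfl
  | cons p e ih =>
    refine (ih.union ((finite_suffixes (p.cons e)).image fun c => ⟨c.1, _, c.2⟩)).subset ?_
    rintro ⟨c, d, q⟩ ⟨l, _ | ⟨r, e'⟩, h⟩
    · exact .inr ⟨⟨c, q⟩, ⟨l, h⟩, rfl⟩
    · cases h
      exact .inl ⟨l, r, rfl⟩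

theorem comp_mem_infixes {a a' b c d d' : V} {c₁ : Path a' b} {c₂ : Path c d'} (h₁ : c₁.length = 0)
    (h₂ : c₂.length = 0) (l : Path a b) (m : Path b c) (r : Path c d) :
    ⟨a', d', (c₁.comp m).comp c₂⟩ ∈ infixes ((l.comp m).comp r) := by
  obtain rfl := c₁.eq_of_length_zero h₁
  obtain rfl := c₂.eq_of_length_zero h₂
  obtain rfl := c₁.eq_nil_of_length_zero h₁
  obtain rfl := c₂.eq_nil_of_length_zero h₂
  exact ⟨l, r, by rw [Path.comp_nil, Path.nil_comp]⟩

end Infixes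

/-- The `1`-cells that occur in the source of some `2`-cell of the polygraph. -/
def sourceInfixes (P : TwoPolygraph.{u, v, w}) : Set (Σ a b : P.Obj, P.Cell1 a b) :=
  ⋃ R : P.AllRules, infixes R.2.2.1

theorem finite_sourceInfixes [Finite P.AllRules] : P.sourceInfixes.Finite :=
  Set.finite_iUnion fun R => finite_infixes R.2.2.1

theorem Step.mem_sourceInfixes {x y : P.Obj} {u v : P.Cell1 x y} (f : Step u v)
    {c : Σ a b : P.Obj, P.Cell1 a b} (hc : c ∈ infixes f.p) : c ∈ P.sourceInfixes :=
  Set.mem_iUnion.2 ⟨⟨_, _, _, _, f.φ⟩, hc⟩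

namespace LocalBranching

open Quiver

variable {b : LocalBranching P}

theorem src_eq_src (b : LocalBranching P) :
    (b.f.l.comp b.f.p).comp b.f.r = (b.g.l.comp b.g.p).comp b.g.r :=
  b.f.src_eq.symm.trans b.g.src_eq

theorem isPeiffer_of_l_eq {m : Path b.f.b b.g.a} (h : b.g.l = (b.f.l.comp b.f.p).comp m) :
    b.IsPeiffer := by
  have hr : b.f.r = (m.comp b.g.p).comp b.g.r := by
    have hs := b.src_eq_src
    rw [h] at hs
    apply Path.comp_injective_right (b.f.l.comp b.f.p)
    simpa only [Path.comp_assoc] using hs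
  refine ⟨_, _, _, _, _, _, _, ⟨b.f.l, b.f.φ, .nil, rfl, rfl⟩, ⟨m, b.g.φ, b.g.r, rfl, rfl⟩, .inl ?_⟩
  exact eq_of_components_eq
    (by simp [Step.components, Step.whiskerRight, hr])
    (by simp [Step.components, Step.whiskerLeft, h])

theorem sub_of_contexts_eq {x' y' : P.Obj} {c : P.Cell1 b.x x'} {d : P.Cell1 y' b.y}
    {l₁ : P.Cell1 x' b.f.a} {l₂ : P.Cell1 x' b.g.a} {r₁ : P.Cell1 b.f.b y'}
    {r₂ : P.Cell1 b.g.b y'} (hl₁ : b.f.l = c.comp l₁) (hl₂ : b.g.l = c.comp l₂)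
    (hr₁ : b.f.r = r₁.comp d) (hr₂ : b.g.r = r₂.comp d) :
    ∃ b' : LocalBranching P, b'.Sub b ∧ b.u.length = c.length + b'.u.length + d.length := by
  have src_eq : (l₁.comp b.f.p).comp r₁ = (l₂.comp b.g.p).comp r₂ := by
    apply Path.comp_injective_right c
    apply Path.comp_injective_left d
    have h := b.src_eq_src
    rw [hl₁, hl₂, hr₁, hr₂] at h
    simpa only [Path.comp_assoc] using h
  refine ⟨⟨⟨l₁, b.f.φ, r₁, rfl, rfl⟩, ⟨l₂, b.g.φ, r₂, src_eq, rfl⟩⟩, ⟨_, _, c, d, ?_⟩, ?_⟩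
  · exact eq_of_components_eq
      (by simp [Step.components, whisker, Step.whiskerLeft, Step.whiskerRight, hl₁, hr₁])
      (by simp [Step.components, whisker, Step.whiskerLeft, Step.whiskerRight, hl₂, hr₂])
  · simp only [b.f.src_eq, hl₁, hr₁, Path.length_comp, add_assoc]

namespace IsCritical

theorem swap (hb : b.IsCritical) : b.swap.IsCritical := by
  refine ⟨⟨fun ha => hb.1.1 ?_, fun hp => hb.1.2 ?_⟩, ?_⟩
  · have hba : b = ⟨b.g, b.g⟩ := congrArg LocalBranching.swap ha
    rw [hba]
    rfl
  · obtain ⟨x, y, z, u, u', v, v', f, g, h⟩ := hp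
    exact ⟨x, y, z, u, u', v, v', f, g, h.symm.imp (congrArg LocalBranching.swap)
      (congrArg LocalBranching.swap)⟩
  · rintro b' ⟨x', y', c, d, h⟩
    obtain ⟨x'', y'', c', d', h'⟩ :=
      hb.2 b'.swap ⟨x', y', c, d, congrArg LocalBranching.swap h⟩
    exact ⟨x'', y'', c', d', congrArg LocalBranching.swap h'⟩

theorem length_contexts_eq_zero (hb : b.IsCritical) {x' y' : P.Obj} {c : P.Cell1 b.x x'}
    {d : P.Cell1 y' b.y} {l₁ : P.Cell1 x' b.f.a} {l₂ : P.Cell1 x' b.g.a} {r₁ : P.Cell1 b.f.b y'}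
    {r₂ : P.Cell1 b.g.b y'} (hl₁ : b.f.l = c.comp l₁) (hl₂ : b.g.l = c.comp l₂)
    (hr₁ : b.f.r = r₁.comp d) (hr₂ : b.g.r = r₂.comp d) : c.length = 0 ∧ d.length = 0 := by
  obtain ⟨b', hsub, hlen⟩ := sub_of_contexts_eq hl₁ hl₂ hr₁ hr₂
  obtain ⟨x'', y'', c', d', rfl⟩ := hb.2 b' hsub
  simp only [whisker, Path.length_comp] at hlen
  omega

theorem l_mem_sourceInfixes (hb : b.IsCritical) : ⟨_, _, b.f.l⟩ ∈ P.sourceInfixes := by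
  have src_eq : b.f.l.comp (b.f.p.comp b.f.r) = b.g.l.comp (b.g.p.comp b.g.r) := by
    simpa only [Path.comp_assoc] using b.src_eq_src
  obtain hle | hle := le_total b.f.l.length b.g.l.length
  · obtain ⟨m, hm, -⟩ := exists_eq_comp_of_comp_eq_comp src_eq hle
    have hl := (hb.length_contexts_eq_zero (c := b.f.l) (d := .nil) (l₁ := .nil) rfl hm rfl rfl).1
    exact b.f.mem_sourceInfixes (by simpa using comp_mem_infixes hl Path.length_nil .nil .nil b.f.p)
  · obtain ⟨m, hm, hmr⟩ := exists_eq_comp_of_comp_eq_comp src_eq.symm hle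
    have hl := (hb.length_contexts_eq_zero (c := b.g.l) (d := .nil) (l₂ := .nil) hm rfl rfl rfl).1
    obtain hle | hle := le_total b.g.p.length m.length
    · obtain ⟨n, rfl, -⟩ := exists_eq_comp_of_comp_eq_comp hmr hle
      rw [← Path.comp_assoc] at hm
      exact absurd (isPeiffer_of_l_eq (b := b.swap) hm) hb.swap.1.2
    · obtain ⟨n, hn, -⟩ := exists_eq_comp_of_comp_eq_comp hmr.symm hle
      refine b.g.mem_sourceInfixes ?_
      rw [hn, hm]
      simpa using comp_mem_infixes hl Path.length_nil .nil m n

theorem r_mem_sourceInfixes (hb : b.IsCritical) : ⟨_, _, b.f.r⟩ ∈ P.sourceInfixes := by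
  obtain hle | hle := le_total (b.g.l.comp b.g.p).length (b.f.l.comp b.f.p).length
  · obtain ⟨m, -, hm⟩ := exists_eq_comp_of_comp_eq_comp b.src_eq_src.symm hle
    have hr := (hb.length_contexts_eq_zero (c := .nil) (d := b.f.r) (r₁ := .nil)
      (Path.nil_comp _).symm (Path.nil_comp _).symm (Path.nil_comp _).symm hm).2
    exact b.f.mem_sourceInfixes (by simpa using comp_mem_infixes Path.length_nil hr b.f.p .nil .nil)
  · obtain ⟨m, hlm, hm⟩ := exists_eq_comp_of_comp_eq_comp b.src_eq_src hle
    have hr := (hb.length_contexts_eq_zero (c := .nil) (d := b.g.r) (r₂ := .nil)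
      (Path.nil_comp _).symm (Path.nil_comp _).symm hm (Path.nil_comp _).symm).2
    obtain hle | hle := le_total (b.f.l.comp b.f.p).length b.g.l.length
    · obtain ⟨n, hn, -⟩ := exists_eq_comp_of_comp_eq_comp hlm.symm hle
      exact absurd (isPeiffer_of_l_eq hn) hb.1.2
    · obtain ⟨n, -, hn⟩ := exists_eq_comp_of_comp_eq_comp hlm hle
      refine b.g.mem_sourceInfixes ?_
      rw [hn, hm]
      simpa using comp_mem_infixes Path.length_nil hr n m .nil

end IsCritical

theorem finite_isCritical [Finite P.AllRules] : {b : LocalBranching P | b.IsCritical}.Finite := by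
  have finite_components := (Set.finite_univ (α := P.AllRules)).prod
    (P.finite_sourceInfixes.prod P.finite_sourceInfixes)
  refine ((finite_components.prod finite_components).preimage
    (f := fun b : LocalBranching P => (b.f.components, b.g.components)) ?_).subset ?_
  · intro b _ b' _ h
    exact eq_of_components_eq (congrArg Prod.fst h) (congrArg Prod.snd h)
  · intro b hb
    exact ⟨⟨trivial, hb.l_mem_sourceInfixes, hb.r_mem_sourceInfixes⟩,
      ⟨trivial, hb.swap.l_mem_sourceInfixes, hb.swap.r_mem_sourceInfixes⟩⟩

end LocalBranching

namespace GlobularExtension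

variable {Γ : GlobularExtension.{u, v, w, t} P}

theorem Cell3.nonempty_of_range_subset {Γ' : GlobularExtension.{u, v, w, _} P}
    (hΓ : Set.range Γ.sphere ⊆ Set.range Γ'.sphere) {x y : P.Obj} {u v : P.Cell1 x y}
    {f g : TCell u v} (A : Γ.Cell3 f g) : Nonempty (Γ'.Cell3 f g) := by
  induction A with
  | gen A =>
    obtain ⟨B, hB⟩ := hΓ ⟨A, rfl⟩
    exact hB ▸ ⟨.gen B⟩
  | id f => exact ⟨.id f⟩
  | inv _ ih => exact ih.map .inv
  | comp₂ _ _ ih₁ ih₂ => exact ih₁.map2 .comp₂ ih₂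
  | comp₁ _ _ ih₁ ih₂ => exact ih₁.map2 .comp₁ ih₂
  | whiskerLeft c _ ih => exact ih.map (.whiskerLeft c)
  | whiskerRight c _ ih => exact ih.map (.whiskerRight c)

theorem IsHomotopyBasis.hasFiniteDerivationType [Finite Γ.Cell] (h : Γ.IsHomotopyBasis) :
    P.HasFiniteDerivationType := by
  obtain ⟨n, ⟨e⟩⟩ := Finite.exists_equiv_fin Γ.Cell
  refine ⟨⟨Fin n, Γ.sphere ∘ e.symm⟩, inferInstanceAs (Finite (Fin n)), fun S => ?_⟩
  exact (h S).some.nonempty_of_range_subset (e.symm.surjective.range_comp Γ.sphere).ge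

end GlobularExtension

end TwoPolygraph

theorem mainTheorem4_general (P : TwoPolygraph.{u, v, w}) {W : Type t} [PartialOrder W]
    [WellFoundedLT W] (ψ : P.Labelling W) (hq : P.IsQuasiNormalizing)
    (hctx : ψ.IsCompatibleWithContexts) (S : TwoPolygraph.StrictSquierCompletion ψ)
    (hpeiffer : ψ.IsPeifferDecreasing S.extension) (hcrit : S.crit.Finite)
    (hloops : Finite P.ElementaryLoopClass) : P.HasFiniteDerivationType := by
  have : Finite S.crit := hcrit.to_subtype
  have : Finite S.extension.Cell := inferInstanceAs (Finite (S.crit ⊕ P.ElementaryLoopClass))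
  exact (S.isHomotopyBasis hq hctx hpeiffer).hasFiniteDerivationType

theorem mainTheorem4 (P : TwoPolygraph.{u, v, w}) {W : Type t} [PartialOrder W] [WellFoundedLT W]
    (ψ : P.Labelling W) (hdec : ψ.IsStrictlyDecreasing) (hqc : P.IsQuasiConvergent)
    (hctx : ψ.IsCompatibleWithContexts) (S : TwoPolygraph.StrictSquierCompletion ψ)
    (hpeiffer : ψ.IsPeifferDecreasing S.extension)
    (hrules : Finite P.AllRules) (hloops : Finite P.ElementaryLoopClass) :
    P.HasFiniteDerivationType :=
  mainTheorem4_general P ψ (TwoPolygraph.IsQuasiTerminating.isQuasiNormalizing hqc.2) hctx S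
    hpeiffer (TwoPolygraph.LocalBranching.finite_isCritical.subset S.isCritical) hloops
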